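/- **Conventions.** Let $\Gamma$ be a discrete group. A *mean* on $\ell^\infty(\Gamma)$ (bounded complex functions) is a positive linear functional $\lambda$ with $\lambda(1)=1$; write $\lambda(A)=\lambda(\chi_A)$ and $\int_A f\,d\lambda=\lambda(\chi_A f)$. The Fourier–Stieltjes algebra $\mathcal B(\Gamma)\subset\ell^\infty(\Gamma)$ is the linear span of all matrix coefficients $\gamma\mapsto\langle\pi(\gamma)x,y\rangle$ of unitary representations of $\Gamma$ on Hilbert spaces. It carries exactly one left $\Gamma$-invariant mean $\eta$, and a *Fourier–Stieltjes mean* is a mean $\lambda$ on $\ell^\infty(\Gamma)$ with $\lambda|_{\mathcal B(\Gamma)}=\eta$ (equivalently, $\lambda|_{\mathcal B(\Gamma)}$ is left $\Gamma$-invariant). The Bohr compactification $(b\Gamma,\iota)$ is the universal compact Hausdorff group with a homomorphism $\iota:\Gamma\to b\Gamma$ (every homomorphism from $\Gamma$ to a compact Hausdorff group factors uniquely through $\iota$ by a continuous homomorphism), and $m_{b\Gamma}$ is its Haar probability measure. For a unitary representation $(\mathcal H,\pi)$, $\mathcal H^\pi$ is the subspace of $\pi$-fixed vectors. For a strongly continuous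 unitary $b\Gamma$-representation $(\mathcal V,\theta)$ and a Borel probability measure $\mu$ on $b\Gamma$, put $\theta(\mu)v=\int_{b\Gamma}\theta(k)v\,d\mu(k)$. **Proposition.** Let $\Gamma$ be a discrete group, $(\mathcal H,\pi)$ a unitary $\Gamma$-representation on a complex Hilbert space, and $\lambda$ a Fourier–Stieltjes mean on $\Gamma$. Let $A\subset\Gamma$ satisfy $\alpha=\lambda(A)>0$. Then there exist 1. a regular Borel probability measure $\mu_A$ on $b\Gamma$, absolutely continuous with respect to $m_{b\Gamma}$, such that $$\operatorname{supp}\mu_A\subset\overline{\iota(A)}\quad\text{and}\quad\Big\|\frac{d\mu_A}{dm_{b\Gamma}}\Big\|_{L^\infty(b\Gamma)}\le\frac1\alpha,$$ 2. a strongly continuous unitary $b\Gamma$-representation $(\mathcal V,\theta)$ and a linear $\Gamma$-equivariant map $Q:(\mathcal H,\pi)\to(\mathcal V,\theta\circ\iota)$ with $\|Q\|_{\mathrm{op}}\le1$ whose restriction $Q:\mathcal H^\pi\to\mathcal V^{\theta\circ\iota}$ is an isometry (i.e. norm-preserving), such that, for all $u\in\mathcal H$ and $\gamma\in\Gamma$,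 $$\operatorname{Re}\big\langle\theta(\mu_A)Qu,\theta(\iota(\gamma))Qu\big\rangle_{\mathcal V}=\frac1{\lambda(A)}\int_A\operatorname{Re}\big\langle\pi(a)u,\pi(\gamma)u\big\rangle_{\mathcal H}\,d\lambda(a).$$ -/

import Mathlib

open MeasureTheory Topology
open scoped ENNReal ComplexOrder

universe u v w

/-! ### The Bohr compactification -/

/-- A compact Hausdorff group `K` with a homomorphism `Γ →* K`, whose underlying set is a subset of
`Set (Set Γ)`.  Every compact Hausdorff group in which the image of `Γ` is dense embeds as a set
into `Set (Set Γ)`, so these form a set of representatives of all compactifications of `Γ`. -/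
structure GroupCompactification (Γ : Type u) [Group Γ] : Type u where
  carrier : Set (Set (Set Γ))
  group : Group carrier
  topology : TopologicalSpace carrier
  isTopologicalGroup : IsTopologicalGroup carrier
  compactSpace : CompactSpace carrier
  t2Space : T2Space carrier
  hom : Γ →* carrier

attribute [instance] GroupCompactification.group GroupCompactification.topology
  GroupCompactification.isTopologicalGroup GroupCompactification.compactSpace
  GroupCompactification.t2Space

/-- The diagonal homomorphism of `Γ` into the product of all its compactifications. -/
def diagonalHom (Γ : Type u) [Group Γ] : Γ →* (∀ i : GroupCompactification Γ, i.carrier) :=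
  MonoidHom.mk' (fun γ i => i.hom γ) (fun a b => by funext i; simp)

/-- The Bohr compactification `bΓ`: the closure of the diagonal image of `Γ` in the product of all
compactifications of `Γ`. -/
def BohrCompactification (Γ : Type u) [Group Γ] : Type u :=
  (diagonalHom Γ).range.topologicalClosure

namespace BohrCompactification

variable (Γ : Type u) [Group Γ]

noncomputable instance : Group (BohrCompactification Γ) :=
  inferInstanceAs (Group (diagonalHom Γ).range.topologicalClosure)

instance : TopologicalSpace (BohrCompactification Γ) :=
  inferInstanceAs (TopologicalSpace (diagonalHom Γ).range.topologicalClosure)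

instance : IsTopologicalGroup (BohrCompactification Γ) :=
  inferInstanceAs (IsTopologicalGroup (diagonalHom Γ).range.topologicalClosure)

instance : T2Space (BohrCompactification Γ) :=
  inferInstanceAs (T2Space (diagonalHom Γ).range.topologicalClosure)

instance : CompactSpace (BohrCompactification Γ) :=
  isCompact_iff_compactSpace.mp
    (diagonalHom Γ).range.isClosed_topologicalClosure.isCompact

/-- The Borel σ-algebra of `bΓ`. -/
instance : MeasurableSpace (BohrCompactification Γ) := borel _

instance : BorelSpace (BohrCompactification Γ) := ⟨rfl⟩

/-- The canonical homomorphism `ι : Γ → bΓ`. -/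
noncomputable def ι : Γ →* BohrCompactification Γ :=
  (Subgroup.inclusion (diagonalHom Γ).range.le_topologicalClosure).comp (diagonalHom Γ).rangeRestrict

/-- The Haar probability measure `m_{bΓ}`. -/
noncomputable def haar : Measure (BohrCompactification Γ) := Measure.haarMeasure ⊤

instance : IsProbabilityMeasure (haar Γ) := ⟨Measure.haarMeasure_self⟩

theorem denseRange_ι : DenseRange (ι Γ) := by
  have key : DenseRange ((Subgroup.inclusion (diagonalHom Γ).range.le_topologicalClosure).comp
      (diagonalHom Γ).rangeRestrict) := by
    intro x
    have h : (Subtype.val '' Set.range ((Subgroup.inclusion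
        (diagonalHom Γ).range.le_topologicalClosure).comp (diagonalHom Γ).rangeRestrict) :
        Set (∀ i : GroupCompactification Γ, i.carrier)) = ((diagonalHom Γ).range : Set _) := by
      ext y
      constructor
      · rintro ⟨_, ⟨γ, rfl⟩, rfl⟩
        exact ⟨γ, rfl⟩
      · rintro ⟨γ, rfl⟩
        exact ⟨_, ⟨γ, rfl⟩, rfl⟩
    rw [closure_subtype, h]
    exact x.2
  exact key

/-- The universal property of `bΓ`: every homomorphism from `Γ` to a compact Hausdorff group
(in any universe) extends uniquely to a continuous homomorphism on `bΓ`. -/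
theorem existsUnique_lift {K : Type w} [Group K] [TopologicalSpace K] [IsTopologicalGroup K]
    [CompactSpace K] [T2Space K] (τ : Γ →* K) :
    ∃! φ : BohrCompactification Γ →ₜ* K, ∀ γ, φ (ι Γ γ) = τ γ := by
  let L : Subgroup K := τ.range.topologicalClosure
  have : CompactSpace L :=
    isCompact_iff_compactSpace.mp τ.range.isClosed_topologicalClosure.isCompact
  let e : L → Set (Set Γ) := fun k => {S | (k : K) ∈ closure (τ '' S)}
  have he : Function.Injective e := by
    intro k l hkl
    by_contra hne
    have hne' : (k : K) ≠ l := fun h => hne (Subtype.ext h)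
    obtain ⟨U, hU, V, hV, hd⟩ := (disjoint_nhds_nhds.mpr hne').exists_mem_filter_basis
      (nhds_basis_opens _) (nhds_basis_opens _)
    have hk : τ ⁻¹' U ∈ e k := by
      change (k : K) ∈ closure (τ '' (τ ⁻¹' U))
      rw [mem_closure_iff]
      intro O hO hkO
      have hk2 : (k : K) ∈ closure (τ.range : Set K) := k.2
      obtain ⟨_, ⟨hyO, hyU⟩, γ, rfl⟩ := mem_closure_iff.mp hk2 (O ∩ U) (hO.inter hU.2) ⟨hkO, hU.1⟩
      exact ⟨_, hyO, γ, hyU, rfl⟩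
    rw [hkl] at hk
    have hl : (l : K) ∈ closure (τ '' (τ ⁻¹' U)) := hk
    obtain ⟨y, hyV, γ, hγ, rfl⟩ := mem_closure_iff.mp hl V hV.2 hV.1
    exact Set.disjoint_left.mp hd hγ hyV
  let E : Set.range e ≃ L := (Equiv.ofInjective e he).symm
  let _ : Group (Set.range e) := E.group
  let _ : TopologicalSpace (Set.range e) := TopologicalSpace.induced E inferInstance
  let M : Set.range e ≃* L := E.mulEquiv
  let N : Set.range e ≃ₜ L := E.toHomeomorphOfIsInducing ⟨rfl⟩
  have : IsTopologicalGroup (Set.range e) := topologicalGroup_induced M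
  have : CompactSpace (Set.range e) := N.symm.compactSpace
  have : T2Space (Set.range e) := N.symm.t2Space
  let τ' : Γ →* L :=
    (Subgroup.inclusion τ.range.le_topologicalClosure).comp τ.rangeRestrict
  let i : GroupCompactification Γ :=
    { carrier := Set.range e
      group := inferInstance
      topology := inferInstance
      isTopologicalGroup := inferInstance
      compactSpace := inferInstance
      t2Space := inferInstance
      hom := M.symm.toMonoidHom.comp τ' }
  let φ : BohrCompactification Γ →ₜ* K :=
    { toFun := fun x => ((M (x.1 i) : L) : K)
      map_one' := by
        change ((M (1 : Set.range e) : L) : K) = 1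
        simp
      map_mul' := fun x y => by
        change ((M ((x.1 i : Set.range e) * (y.1 i : Set.range e)) : L) : K) = _
        simp
      continuous_toFun := by
        refine continuous_subtype_val.comp (N.continuous.comp ?_)
        exact (continuous_apply i).comp continuous_subtype_val }
  have hφ : ∀ γ, φ (ι Γ γ) = τ γ := by
    intro γ
    change ((M (M.symm (τ' γ)) : L) : K) = τ γ
    rw [MulEquiv.apply_symm_apply]
    rfl
  refine ⟨φ, hφ, fun ψ hψ => ?_⟩
  apply DFunLike.coe_injective
  refine (denseRange_ι Γ).equalizer (map_continuous ψ) (map_continuous φ) ?_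
  funext γ
  exact (hψ γ).trans (hφ γ).symm

end BohrCompactification

/-! ### Unitary representations -/

section Representations

variable {G : Type u} [Group G] {H : Type v} [NormedAddCommGroup H] [InnerProductSpace ℂ H]
  [CompleteSpace H]

/-- The subspace `H^π` of vectors fixed by the unitary representation `π`. -/
def fixedVectors (π : G →* unitary (H →L[ℂ] H)) : Submodule ℂ H where
  carrier := {x | ∀ g, (π g : H →L[ℂ] H) x = x}
  add_mem' := fun {x y} hx hy g => by rw [map_add, hx g, hy g]
  zero_mem' := fun g => map_zero _
  smul_mem' := fun c x hx g => by rw [map_smul, hx g]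

/-- Strong continuity of a unitary representation. -/
def StronglyContinuous [TopologicalSpace G] (π : G →* unitary (H →L[ℂ] H)) : Prop :=
  ∀ x : H, Continuous fun g => (π g : H →L[ℂ] H) x

/-- `θ(μ)x = ∫ θ(k)x dμ(k)`, as a Bochner integral. -/
noncomputable def averageOp [MeasurableSpace G] (θ : G →* unitary (H →L[ℂ] H)) (μ : Measure G)
    (x : H) : H :=
  ∫ k, (θ k : H →L[ℂ] H) x ∂μ

end Representations

/-! ### Means on `ℓ^∞(Γ)` and the Fourier–Stieltjes algebra -/

section Means

/-- The space `ℓ^∞(Γ)` of bounded complex functions on `Γ`. -/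
abbrev EllInf (Γ : Type u) : Type u := lp (fun _ : Γ => ℂ) ∞

/-- A bounded function, as an element of `ℓ^∞(Γ)`. -/
def EllInf.mk {Γ : Type u} (f : Γ → ℂ) (C : ℝ) (hf : ∀ γ, ‖f γ‖ ≤ C) : EllInf Γ :=
  ⟨f, memℓp_infty ⟨C, by rintro _ ⟨γ, rfl⟩; exact hf γ⟩⟩

/-- The indicator function `χ_A`. -/
noncomputable def EllInf.chi {Γ : Type u} (A : Set Γ) : EllInf Γ :=
  EllInf.mk (A.indicator 1) 1 fun γ => by
    by_cases h : γ ∈ A <;> simp [h]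

variable {Γ : Type u} [Group Γ]

/-- The left translate `x ↦ f (γ⁻¹ x)`. -/
noncomputable def EllInf.translate (γ : Γ) (f : EllInf Γ) : EllInf Γ :=
  EllInf.mk (fun x => f (γ⁻¹ * x)) ‖f‖ fun x => lp.norm_apply_le_norm (by simp) f _

/-- A mean: a positive unital linear functional on `ℓ^∞(Γ)`. -/
structure IsMean (Λ : EllInf Γ →ₗ[ℂ] ℂ) : Prop where
  nonneg : ∀ f : EllInf Γ, (∀ γ, 0 ≤ f γ) → 0 ≤ Λ f
  map_one : Λ 1 = 1

/-- The Fourier–Stieltjes algebra `B(Γ)`: the span of all matrix coefficients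
`γ ↦ ⟨π(γ)x, y⟩` of unitary representations of `Γ` on Hilbert spaces.  (Replacing a Hilbert space
by the cyclic subspace generated by `x` shows that spaces in the universe of `Γ` suffice.) -/
noncomputable def fourierStieltjes (Γ : Type u) [Group Γ] : Submodule ℂ (EllInf Γ) :=
  Submodule.span ℂ
    {f | ∃ (H : Type u) (_ : NormedAddCommGroup H) (_ : InnerProductSpace ℂ H)
      (_ : CompleteSpace H) (π : Γ →* unitary (H →L[ℂ] H)) (x y : H),
      ∀ γ, f γ = inner ℂ y ((π γ : H →L[ℂ] H) x)}

/-- A Fourier–Stieltjes mean: a mean on `ℓ^∞(Γ)` whose restriction to `B(Γ)` is the left-invariant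
mean on `B(Γ)`.  (There is exactly one left-invariant mean on `B(Γ)`, so this says that the
restriction is left-invariant.) -/
structure IsFourierStieltjesMean (Λ : EllInf Γ →ₗ[ℂ] ℂ) : Prop where
  isMean : IsMean Λ
  left_invariant : ∀ f ∈ fourierStieltjes Γ, ∀ γ, Λ (EllInf.translate γ f) = Λ f

/-- `∫_A f dλ = λ(χ_A f)`. -/
noncomputable def meanIntegral (Λ : EllInf Γ →ₗ[ℂ] ℂ) (A : Set Γ) (f : EllInf Γ) : ℂ :=
  Λ (EllInf.chi A * f)

/-- The bounded function `a ↦ Re ⟨π(a)x, y⟩`. -/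
noncomputable def reCoeff {H : Type v} [NormedAddCommGroup H] [InnerProductSpace ℂ H]
    [CompleteSpace H] (π : Γ →* unitary (H →L[ℂ] H)) (x y : H) : EllInf Γ :=
  EllInf.mk (fun a => ((inner ℂ ((π a : H →L[ℂ] H) x) y).re : ℂ)) (‖x‖ * ‖y‖) fun a => by
    rw [Complex.norm_real, Real.norm_eq_abs]
    refine (Complex.abs_re_le_norm _).trans ((norm_inner_le_norm _ _).trans ?_)
    rw [Unitary.norm_map]

end Means

/-! Split `H` orthogonally into the almost periodic vectors, whose orbit maps extend continuously to
`bΓ`, and their complement. `bΓ` acts on the first summand by the extended orbit maps; this action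
is `θ`, and `Q` is the orthogonal projection. Fixed vectors are almost periodic, so `Q` is isometric
on them.

The complement contributes nothing. For `x` in it, the averaged rank-one operator `T = ∫
|π(γ)x⟩⟨π(γ)x| dλ` is positive of trace at most `‖x‖²`, hence compact. It commutes with `π`, because
products of a coefficient with a conjugate coefficient lie in `B(Γ)`, where `λ` is invariant. Its
eigenspaces for nonzero eigenvalues are finite-dimensional and invariant, hence almost periodic, but
`T` kills almost periodic vectors; so `T = 0` (`meanOp_eq_zero`). Cauchy–Schwarz against `χ_A` then
gives `∫_A ⟨π(a)x, w⟩ dλ = 0`.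

On the almost periodic part the correlation is the restriction to `Γ` of a continuous function on
`bΓ`, so only `φ ↦ α⁻¹ ∫_A φ ∘ ι dλ` matters, and Riesz represents it by `μ_A`. Since `λ` restricts
to Haar measure on `C(bΓ)` (`mean_pullback_eq_integral`) and `χ_A ≤ 1`, the density of `μ_A` is at
most `1/α`. -/

/-! ### Positivity and Cauchy–Schwarz for means -/

section MeanLemmas

variable {Γ : Type u}

@[simp]
theorem EllInf.mk_apply (f : Γ → ℂ) (C : ℝ) (hf : ∀ γ, ‖f γ‖ ≤ C) (γ : Γ) :
    EllInf.mk f C hf γ = f γ := rfl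

theorem EllInf.norm_apply_le (f : EllInf Γ) (γ : Γ) : ‖f γ‖ ≤ ‖f‖ :=
  lp.norm_apply_le_norm (by simp) f γ

theorem EllInf.norm_le {f : EllInf Γ} {C : ℝ} (hC : 0 ≤ C) (hf : ∀ γ, ‖f γ‖ ≤ C) : ‖f‖ ≤ C :=
  lp.norm_le_of_forall_le hC hf

@[simp] theorem EllInf.add_apply (f g : EllInf Γ) (γ : Γ) : (f + g) γ = f γ + g γ := rfl
@[simp] theorem EllInf.sub_apply (f g : EllInf Γ) (γ : Γ) : (f - g) γ = f γ - g γ := rfl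
@[simp] theorem EllInf.smul_apply (c : ℂ) (f : EllInf Γ) (γ : Γ) : (c • f) γ = c * f γ := rfl
@[simp] theorem EllInf.mul_apply (f g : EllInf Γ) (γ : Γ) : (f * g) γ = f γ * g γ := rfl
@[simp] theorem EllInf.one_apply (γ : Γ) : (1 : EllInf Γ) γ = 1 := rfl
@[simp] theorem EllInf.zero_apply (γ : Γ) : (0 : EllInf Γ) γ = 0 := rfl
@[simp] theorem EllInf.star_apply (f : EllInf Γ) (γ : Γ) : (star f) γ = star (f γ) := rfl

theorem EllInf.ext {f g : EllInf Γ} (h : ∀ γ, f γ = g γ) : f = g := lp.ext (funext h)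

theorem EllInf.star_star_mul (f g : EllInf Γ) : star (star g * f) = star f * g :=
  EllInf.ext fun γ => by simp [mul_comm]

namespace IsMean

variable {Λ : EllInf Γ →ₗ[ℂ] ℂ}

theorem im_eq_zero (hΛ : IsMean Λ) {f : EllInf Γ} (hf : ∀ γ, (f γ).im = 0) : (Λ f).im = 0 := by
  -- Shifting a real function by its sup norm makes it nonnegative.
  have h := hΛ.nonneg (f + (‖f‖ : ℂ) • 1) fun γ => by
    rw [EllInf.add_apply, EllInf.smul_apply, EllInf.one_apply, mul_one, Complex.le_def]
    have h1 := (abs_le.mp ((Complex.abs_re_le_norm (f γ)).trans (f.norm_apply_le γ))).1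
    constructor
    · simp; linarith
    · simp [hf γ]
  rw [map_add, map_smul, hΛ.map_one, Complex.le_def] at h
  simpa using h.2.symm

theorem map_star (hΛ : IsMean Λ) (f : EllInf Γ) : Λ (star f) = star (Λ f) := by
  have h1 := hΛ.im_eq_zero (f := f + star f) fun γ => by simp
  have h2 := hΛ.im_eq_zero (f := Complex.I • (f - star f)) fun γ => by simp
  simp only [map_add, map_sub, map_smul] at h1 h2
  apply Complex.ext
  · simp at h2 ⊢; linarith
  · simp at h1 ⊢; linarith

/-- The pre-inner product `⟨f, g⟩ = λ(f̄ g)` associated with a mean. -/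
noncomputable abbrev innerCore (hΛ : IsMean Λ) : PreInnerProductSpace.Core ℂ (EllInf Γ) where
  inner f g := Λ (star f * g)
  conj_inner_symm f g := by
    change star (Λ (star g * f)) = Λ (star f * g)
    rw [← hΛ.map_star, EllInf.star_star_mul]
  re_inner_nonneg f := by
    have h := hΛ.nonneg (star f * f) fun γ => by
      simpa using star_mul_self_nonneg (f γ)
    exact (Complex.le_def.mp h).1
  add_left f g h := by
    change Λ (star (f + g) * h) = Λ (star f * h) + Λ (star g * h)
    rw [star_add, add_mul, map_add]
  smul_left f g r := by
    change Λ (star (r • f) * g) = star r * Λ (star f * g)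
    rw [star_smul, smul_mul_assoc, map_smul, smul_eq_mul]

theorem re_star_mul_self_nonneg (hΛ : IsMean Λ) (f : EllInf Γ) : 0 ≤ (Λ (star f * f)).re :=
  hΛ.innerCore.re_inner_nonneg f

theorem norm_star_mul_sq_le (hΛ : IsMean Λ) (f g : EllInf Γ) :
    ‖Λ (star f * g)‖ ^ 2 ≤ (Λ (star f * f)).re * (Λ (star g * g)).re := by
  have h := @InnerProductSpace.Core.inner_mul_inner_self_le ℂ (EllInf Γ) _ _ _ hΛ.innerCore f g
  have h2 : ‖Λ (star g * f)‖ = ‖Λ (star f * g)‖ := by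
    rw [← norm_star, ← hΛ.map_star, EllInf.star_star_mul]
  rw [sq]
  nth_rw 2 [← h2]
  exact h

theorem re_le_of_le (hΛ : IsMean Λ) {f : EllInf Γ} {C : ℝ} (hf : ∀ γ, f γ ≤ C) :
    (Λ f).re ≤ C := by
  have h := hΛ.nonneg ((C : ℂ) • 1 - f) fun γ => by
    rw [EllInf.sub_apply, EllInf.smul_apply, EllInf.one_apply, mul_one]
    exact sub_nonneg.mpr (hf γ)
  rw [map_sub, map_smul, hΛ.map_one, Complex.le_def] at h
  simpa using h.1

/-- Cauchy–Schwarz against the constant 1 reduces complex `f` to the real function `|f|²`. -/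
theorem norm_le (hΛ : IsMean Λ) (f : EllInf Γ) : ‖Λ f‖ ≤ ‖f‖ := by
  have h := hΛ.norm_star_mul_sq_le 1 f
  rw [star_one, one_mul, one_mul, hΛ.map_one, Complex.one_re, one_mul] at h
  refine le_of_sq_le_sq (h.trans (hΛ.re_le_of_le fun γ => ?_)) (norm_nonneg _)
  rw [EllInf.mul_apply, EllInf.star_apply, ← starRingEnd_apply, ← Complex.normSq_eq_conj_mul_self,
    Complex.normSq_eq_norm_sq]
  exact Complex.real_le_real.mpr <| pow_le_pow_left₀ (norm_nonneg _) (f.norm_apply_le γ) 2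

theorem re_nonneg (hΛ : IsMean Λ) {f : EllInf Γ} (hf : ∀ γ, 0 ≤ f γ) : 0 ≤ (Λ f).re :=
  (Complex.le_def.mp (hΛ.nonneg f hf)).1

end IsMean

end MeanLemmas

/-! ### Hilbert spaces from Gram kernels -/

section Gram

/-- Finitely supported functions on `X`, with the semi-inner product pulled back along the linear
extension of `v : X → E`. -/
def GramSpace {X : Type u} {E : Type w} (_v : X → E) : Type u := X →₀ ℂ

variable {X : Type u} {E : Type w} (v : X → E)

namespace GramSpace

noncomputable instance : AddCommGroup (GramSpace v) := inferInstanceAs (AddCommGroup (X →₀ ℂ))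

noncomputable instance : Module ℂ (GramSpace v) := inferInstanceAs (Module ℂ (X →₀ ℂ))

/-- The indicator function of a point. -/
noncomputable def basisVec (x : X) : GramSpace v := Finsupp.single x 1

/-- The linear extension of a self-map of `X`. -/
noncomputable def mapDomain (σ : X → X) : GramSpace v →ₗ[ℂ] GramSpace v :=
  Finsupp.lmapDomain ℂ ℂ σ

@[simp]
theorem mapDomain_basisVec (σ : X → X) (x : X) :
    mapDomain v σ (basisVec v x) = basisVec v (σ x) :=
  Finsupp.mapDomain_single

theorem mapDomain_comp (σ τ : X → X) (x : GramSpace v) :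
    mapDomain v (σ ∘ τ) x = mapDomain v σ (mapDomain v τ x) :=
  Finsupp.mapDomain_comp

theorem mapDomain_id (x : GramSpace v) : mapDomain v id x = x :=
  Finsupp.mapDomain_id

variable [NormedAddCommGroup E] [InnerProductSpace ℂ E]

/-- The linear extension of `v`. -/
noncomputable def toAmbient : GramSpace v →ₗ[ℂ] E := Finsupp.linearCombination ℂ v

@[simp]
theorem toAmbient_basisVec (x : X) : toAmbient v (basisVec v x) = v x :=
  (Finsupp.linearCombination_single ℂ 1 x).trans (one_smul _ _)

/-- Only a seminorm, since `v` may be linearly dependent; the completion used later is separated.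
The space stays in the universe of `X`, whatever that of `E`. -/
noncomputable instance : SeminormedAddCommGroup (GramSpace v) :=
  SeminormedAddCommGroup.induced _ _ (toAmbient v)

noncomputable instance : InnerProductSpace ℂ (GramSpace v) where
  norm_smul_le c x := by
    change ‖toAmbient v (c • x)‖ ≤ ‖c‖ * ‖toAmbient v x‖
    rw [map_smul, norm_smul]
  inner x y := inner ℂ (toAmbient v x) (toAmbient v y)
  norm_sq_eq_re_inner x := norm_sq_eq_re_inner (toAmbient v x)
  conj_inner_symm x y := inner_conj_symm _ _
  add_left x y z := by rw [map_add, inner_add_left]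
  smul_left x y c := by rw [map_smul, inner_smul_left]

theorem inner_def (x y : GramSpace v) :
    inner ℂ x y = inner ℂ (toAmbient v x) (toAmbient v y) := rfl

variable {v}

theorem inner_mapDomain {σ : X → X}
    (hσ : ∀ x y, inner ℂ (v (σ x)) (v (σ y)) = inner ℂ (v x) (v y)) (x y : GramSpace v) :
    inner ℂ (mapDomain v σ x) (mapDomain v σ y) = inner ℂ x y := by
  have key : ∀ z : GramSpace v,
      toAmbient v (mapDomain v σ z) = Finsupp.linearCombination ℂ (v ∘ σ) z :=
    fun z => Finsupp.linearCombination_mapDomain ℂ σ z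
  have key₂ : ∀ c d : X →₀ ℂ,
      inner ℂ (Finsupp.linearCombination ℂ (v ∘ σ) c) (Finsupp.linearCombination ℂ (v ∘ σ) d) =
        inner ℂ (Finsupp.linearCombination ℂ v c) (Finsupp.linearCombination ℂ v d) := by
    intro c d
    simp [Finsupp.linearCombination_apply, Finsupp.sum_inner, Finsupp.inner_sum, hσ]
  rw [inner_def, inner_def, key, key]
  exact key₂ x y

/-- The isometry of the Gram space induced by a map preserving Gram kernels. -/
noncomputable def isometry (σ : X → X)
    (hσ : ∀ x y, inner ℂ (v (σ x)) (v (σ y)) = inner ℂ (v x) (v y)) :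
    GramSpace v →ₗᵢ[ℂ] GramSpace v where
  __ := mapDomain v σ
  norm_map' x := by
    have h : inner ℂ (mapDomain v σ x) (mapDomain v σ x) = inner ℂ x x := inner_mapDomain hσ x x
    change ‖mapDomain v σ x‖ = ‖x‖
    rw [@norm_eq_sqrt_re_inner ℂ, h, ← @norm_eq_sqrt_re_inner ℂ]

theorem isometry_apply (σ : X → X)
    (hσ : ∀ x y, inner ℂ (v (σ x)) (v (σ y)) = inner ℂ (v x) (v y)) (x : GramSpace v) :
    isometry σ hσ x = mapDomain v σ x := rfl

/-- The operator induced on the completion of the Gram space. -/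
noncomputable def completionMap (σ : X → X)
    (hσ : ∀ x y, inner ℂ (v (σ x)) (v (σ y)) = inner ℂ (v x) (v y)) :
    UniformSpace.Completion (GramSpace v) →L[ℂ] UniformSpace.Completion (GramSpace v) :=
  (isometry σ hσ).toContinuousLinearMap.completion

theorem completionMap_coe (σ : X → X)
    (hσ : ∀ x y, inner ℂ (v (σ x)) (v (σ y)) = inner ℂ (v x) (v y)) (x : GramSpace v) :
    completionMap σ hσ (x : UniformSpace.Completion (GramSpace v)) =
      (mapDomain v σ x : GramSpace v) :=
  ContinuousLinearMap.completion_apply_coe _ _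

end GramSpace

end Gram

/-! ### Unitary representations from isometric actions -/

section Unitary

variable {G : Type u} [Group G] {H : Type v} [NormedAddCommGroup H] [InnerProductSpace ℂ H]
  [CompleteSpace H]

/-- A homomorphism into the bounded operators whose values preserve the inner product
is a unitary representation. -/
noncomputable def unitaryRepOfIsometry (ρ : G →* (H →L[ℂ] H)) (hρ : ∀ g x, ‖ρ g x‖ = ‖x‖) :
    G →* unitary (H →L[ℂ] H) where
  toFun g := ⟨ρ g, by
    have h1 : ∀ g, star (ρ g) * ρ g = 1 := fun g =>
      (ContinuousLinearMap.norm_map_iff_adjoint_comp_self (ρ g)).mp (hρ g)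
    -- An isometry has its adjoint as left inverse; the group inverse supplies a right inverse, so
    -- the two coincide.
    have h2 : ρ g * ρ g⁻¹ = 1 := by rw [← map_mul, mul_inv_cancel, map_one]
    refine Unitary.mem_iff.mpr ⟨h1 g, ?_⟩
    rw [← left_inv_eq_right_inv (h1 g) h2] at h2
    exact h2⟩
  map_one' := Subtype.ext (map_one ρ)
  map_mul' g h := Subtype.ext (map_mul ρ g h)

@[simp]
theorem unitaryRepOfIsometry_apply (ρ : G →* (H →L[ℂ] H)) (hρ : ∀ g x, ‖ρ g x‖ = ‖x‖) (g : G) :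
    (unitaryRepOfIsometry ρ hρ g : H →L[ℂ] H) = ρ g := rfl

theorem unitaryRep_mul_apply (π : G →* unitary (H →L[ℂ] H)) (g h : G) (x : H) :
    (π (g * h) : H →L[ℂ] H) x = (π g : H →L[ℂ] H) ((π h : H →L[ℂ] H) x) := by
  rw [map_mul]; rfl

@[simp]
theorem unitaryRep_one_apply (π : G →* unitary (H →L[ℂ] H)) (x : H) :
    (π 1 : H →L[ℂ] H) x = x := by
  rw [map_one]; rfl

@[simp]
theorem unitaryRep_norm_apply (π : G →* unitary (H →L[ℂ] H)) (g : G) (x : H) :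
    ‖(π g : H →L[ℂ] H) x‖ = ‖x‖ := Unitary.norm_map _ _

@[simp]
theorem unitaryRep_inner_apply (π : G →* unitary (H →L[ℂ] H)) (g : G) (x y : H) :
    inner ℂ ((π g : H →L[ℂ] H) x) ((π g : H →L[ℂ] H) y) = inner ℂ x y :=
  Unitary.inner_map_map _ _ _

end Unitary

/-! ### Membership in `B(Γ)` -/

section FourierStieltjes

variable {Γ : Type u} [Group Γ]

/-- Matrix coefficients of an invariant Gram kernel (in any universe) lie in `B(Γ)`. -/
theorem mem_fourierStieltjes_of_gram {J : Type u} {E : Type w} [NormedAddCommGroup E]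
    [InnerProductSpace ℂ E] (v : Γ × J → E)
    (hv : ∀ g a b i j, inner ℂ (v (g * a, i)) (v (g * b, j)) = inner ℂ (v (a, i)) (v (b, j)))
    (i j : J) (f : EllInf Γ) (hf : ∀ γ, f γ = inner ℂ (v (1, i)) (v (γ, j))) :
    f ∈ fourierStieltjes Γ := by
  -- Left multiplication on the first factor preserves the kernel by `hv`, so it extends to a
  -- unitary representation on the completed Gram space, which lies in the universe that
  -- `fourierStieltjes` demands.
  let σ : Γ → Γ × J → Γ × J := fun g x => (g * x.1, x.2)
  have hσ : ∀ g x y, inner ℂ (v (σ g x)) (v (σ g y)) = inner ℂ (v x) (v y) :=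
    fun g x y => hv g _ _ _ _
  let ρ : Γ →* (UniformSpace.Completion (GramSpace v) →L[ℂ]
      UniformSpace.Completion (GramSpace v)) :=
    { toFun g := GramSpace.completionMap (σ g) (hσ g)
      map_one' := by
        ext x
        refine UniformSpace.Completion.induction_on x
          (isClosed_eq (ContinuousLinearMap.continuous _) continuous_id) fun x => ?_
        have : σ 1 = id := by funext x; simp [σ]
        rw [GramSpace.completionMap_coe, this, GramSpace.mapDomain_id]
        rfl
      map_mul' g h := by
        ext x
        refine UniformSpace.Completion.induction_on x
          (isClosed_eq (ContinuousLinearMap.continuous _) (ContinuousLinearMap.continuous _))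
          fun x => ?_
        have : σ (g * h) = σ g ∘ σ h := by funext x; simp [σ, mul_assoc]
        change _ = GramSpace.completionMap (σ g) (hσ g) (GramSpace.completionMap (σ h) (hσ h) _)
        rw [GramSpace.completionMap_coe, GramSpace.completionMap_coe, GramSpace.completionMap_coe,
          this, GramSpace.mapDomain_comp] }
  have hρ : ∀ g x, ‖ρ g x‖ = ‖x‖ := by
    intro g x
    refine UniformSpace.Completion.induction_on x
      (isClosed_eq (ContinuousLinearMap.continuous _).norm continuous_norm) fun x => ?_
    change ‖GramSpace.completionMap (σ g) (hσ g) _‖ = _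
    rw [GramSpace.completionMap_coe, UniformSpace.Completion.norm_coe,
      UniformSpace.Completion.norm_coe, ← GramSpace.isometry_apply _ (hσ g),
      LinearIsometry.norm_map]
  refine Submodule.subset_span ⟨UniformSpace.Completion (GramSpace v), inferInstance,
    inferInstance, inferInstance, unitaryRepOfIsometry ρ hρ,
    (GramSpace.basisVec v (1, j) : GramSpace v), (GramSpace.basisVec v (1, i) : GramSpace v),
    fun γ => ?_⟩
  rw [hf, unitaryRepOfIsometry_apply]
  change _ = inner ℂ _ (GramSpace.completionMap (σ γ) (hσ γ) _)
  rw [GramSpace.completionMap_coe, UniformSpace.Completion.inner_coe, GramSpace.inner_def]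
  simp [σ]

end FourierStieltjes

/-- Elementary tensors `x ⊗ ȳ`, realised in a Hilbert sum of copies of `H`. -/
theorem exists_tensor_conj (H : Type v) [NormedAddCommGroup H] [InnerProductSpace ℂ H]
    [CompleteSpace H] :
    ∃ (E : Type v) (_ : NormedAddCommGroup E) (_ : InnerProductSpace ℂ E) (t : H → H → E),
      ∀ x y x' y', inner ℂ (t x y) (t x' y') = inner ℂ x x' * inner ℂ y' y := by
  obtain ⟨I, b, -⟩ := exists_hilbertBasis ℂ H
  -- The tensor is the family of values at the basis vectors of the rank-one operator `z ↦ ⟨y, z⟩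
  -- x`; Parseval computes its inner products.
  have hmem : ∀ x y : H, Memℓp (fun i : I => (inner ℂ y (b i)) • x) 2 := by
    intro x y
    have h := (lp.memℓp (b.repr y)).const_smul (‖x‖ : ℂ)
    rw [memℓp_gen_iff (by norm_num)] at h ⊢
    refine h.congr fun i => ?_
    rw [Pi.smul_apply, norm_smul, norm_smul, b.repr_apply_apply, norm_inner_symm, mul_comm]
    simp
  refine ⟨lp (fun _ : I => H) 2, inferInstance, inferInstance, fun x y => ⟨_, hmem x y⟩, ?_⟩
  intro x y x' y'
  rw [lp.inner_eq_tsum]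
  simp only [inner_smul_left, inner_smul_right, inner_conj_symm]
  have := b.hasSum_inner_mul_inner y' y
  rw [← this.tsum_eq, ← tsum_mul_left]
  exact tsum_congr fun i => by ring

section Products

variable {Γ : Type u} [Group Γ] {H : Type v} [NormedAddCommGroup H] [InnerProductSpace ℂ H]
  [CompleteSpace H]

/-- This is a coefficient of `π ⊗ π̄`, between `w₁ ⊗ w̄₂` and `x ⊗ x̄`. -/
theorem mul_coeff_mem_fourierStieltjes (π : Γ →* unitary (H →L[ℂ] H)) (x w₁ w₂ : H)
    (f : EllInf Γ)
    (hf : ∀ γ, f γ = inner ℂ w₁ ((π γ : H →L[ℂ] H) x) * inner ℂ ((π γ : H →L[ℂ] H) x) w₂) :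
    f ∈ fourierStieltjes Γ := by
  obtain ⟨E, _, _, t, ht⟩ := exists_tensor_conj H
  refine mem_fourierStieltjes_of_gram (J := ULift Bool)
    (fun p => bif p.2.down then t ((π p.1 : H →L[ℂ] H) w₁) ((π p.1 : H →L[ℂ] H) w₂)
      else t ((π p.1 : H →L[ℂ] H) x) ((π p.1 : H →L[ℂ] H) x)) ?_ ⟨true⟩ ⟨false⟩ f ?_
  · rintro g a b ⟨i⟩ ⟨j⟩
    cases i <;> cases j <;> simp [ht]
  · intro γ
    simp [ht, hf]

end Products

/-! ### Fourier–Stieltjes means restrict to Haar measure -/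

namespace BohrCompactification

variable {Γ : Type u} [Group Γ]

instance : (haar Γ).IsHaarMeasure := inferInstanceAs (Measure.haarMeasure ⊤).IsHaarMeasure

/-- A right translate is again a Haar probability measure, and that is unique. -/
instance : (haar Γ).IsMulRightInvariant where
  map_mul_right_eq_self g := by
    have : IsProbabilityMeasure ((haar Γ).map (· * g)) :=
      Measure.isProbabilityMeasure_map (measurable_mul_const g).aemeasurable
    exact Measure.isHaarMeasure_eq_of_isProbabilityMeasure _ _

/-- Restriction of continuous functions on `bΓ` to `Γ`. -/
noncomputable def pullback : C(BohrCompactification Γ, ℂ) →ₗ[ℂ] EllInf Γ where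
  toFun φ := EllInf.mk (fun γ => φ (ι Γ γ)) ‖φ‖ fun _ => φ.norm_coe_le_norm _
  map_add' _ _ := rfl
  map_smul' _ _ := rfl

@[simp]
theorem pullback_apply (φ : C(BohrCompactification Γ, ℂ)) (γ : Γ) :
    pullback φ γ = φ (ι Γ γ) := rfl

theorem norm_pullback_le (φ : C(BohrCompactification Γ, ℂ)) : ‖pullback φ‖ ≤ ‖φ‖ :=
  EllInf.norm_le (norm_nonneg _) fun _ => φ.norm_coe_le_norm _

/-- The left translate `x ↦ φ (k x)`. -/
noncomputable def leftTranslate (k : BohrCompactification Γ) (φ : C(BohrCompactification Γ, ℂ)) :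
    C(BohrCompactification Γ, ℂ) := φ.comp ⟨fun x => k * x, by fun_prop⟩

@[simp]
theorem leftTranslate_apply (k x : BohrCompactification Γ) (φ : C(BohrCompactification Γ, ℂ)) :
    leftTranslate k φ x = φ (k * x) := rfl

theorem continuous_leftTranslate (φ : C(BohrCompactification Γ, ℂ)) :
    Continuous fun k => leftTranslate k φ := by
  let F : C(BohrCompactification Γ × BohrCompactification Γ, ℂ) :=
    ⟨fun p => φ (p.1 * p.2), by fun_prop⟩
  exact F.curry.continuous

/-- The convolution is a coefficient of the left regular representation on `L²(bΓ)` restricted to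
`Γ`, for the vectors `ḡ` and `x ↦ φ(x⁻¹)`. -/
theorem integral_inv_mul_mem_fourierStieltjes (φ g : C(BohrCompactification Γ, ℂ))
    (f : EllInf Γ) (hf : ∀ γ, f γ = ∫ x, φ (x⁻¹ * ι Γ γ) * g x ∂haar Γ) :
    f ∈ fourierStieltjes Γ := by
  let t : C(BohrCompactification Γ, ℂ) → Lp ℂ 2 (haar Γ) :=
    ContinuousMap.toLp 2 (haar Γ) ℂ
  have ht : ∀ a b, inner ℂ (t a) (t b) = ∫ x, b x * star (a x) ∂haar Γ :=
    fun a b => ContinuousMap.inner_toLp (haar Γ) a b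
  let ψ : ULift.{u} Bool → C(BohrCompactification Γ, ℂ) := fun j =>
    bif j.down then star g else φ.comp ⟨fun x => x⁻¹, by fun_prop⟩
  refine mem_fourierStieltjes_of_gram (J := ULift Bool)
    (fun p => t (leftTranslate (ι Γ p.1)⁻¹ (ψ p.2))) ?_ ⟨true⟩ ⟨false⟩ f ?_
  · intro g a b i j
    simp only [ht, leftTranslate_apply, map_mul, mul_inv_rev]
    rw [← integral_mul_left_eq_self (fun x => ψ j ((ι Γ b)⁻¹ * x) * star (ψ i ((ι Γ a)⁻¹ * x)))
      (ι Γ g)⁻¹]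
    simp only [mul_assoc]
  · intro γ
    simp [hf, ht, ψ]

/-- Convolve with a normalised bump `G` supported where translation moves `φ` by less than `ε`
uniformly. -/
theorem exists_mem_fourierStieltjes_norm_sub_le (φ : C(BohrCompactification Γ, ℂ)) {ε : ℝ}
    (hε : 0 < ε) : ∃ f ∈ fourierStieltjes Γ, ‖f - pullback φ‖ ≤ ε := by
  have hcont := (continuous_leftTranslate φ).comp (continuous_inv (G := BohrCompactification Γ))
  have hU : {x : BohrCompactification Γ | dist (leftTranslate x⁻¹ φ) φ < ε} ∈ 𝓝 1 := by
    refine (isOpen_lt (hcont.dist continuous_const) continuous_const).mem_nhds ?_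
    have : leftTranslate (1 : BohrCompactification Γ) φ = φ := by ext; simp
    simpa [this] using hε
  obtain ⟨U, hUs, hUo, h1U⟩ := mem_nhds_iff.mp hU
  obtain ⟨g, hg0, hg1, hg⟩ := exists_continuous_zero_one_of_isClosed hUo.isClosed_compl
    (isClosed_singleton (x := (1 : BohrCompactification Γ)))
    (Set.disjoint_singleton_right.mpr fun h => h h1U)
  have hgint : Integrable g (haar Γ) := g.continuous.integrable_of_hasCompactSupport
    (HasCompactSupport.of_compactSpace _)
  have hpos : 0 < ∫ x, g x ∂haar Γ := by
    refine (integral_pos_iff_support_of_nonneg (fun x => (hg x).1) hgint).mpr ?_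
    refine g.continuous.isOpen_support.measure_pos _ ⟨1, ?_⟩
    simp [hg1 rfl]
  set c := ∫ x, g x ∂haar Γ with hc
  let G : C(BohrCompactification Γ, ℂ) := ⟨fun x => ((c⁻¹ * g x : ℝ) : ℂ), by fun_prop⟩
  have hint : ∀ F : C(BohrCompactification Γ, ℂ), Integrable F (haar Γ) := fun F =>
    F.continuous.integrable_of_hasCompactSupport (HasCompactSupport.of_compactSpace _)
  have hG1 : ∫ x, G x ∂haar Γ = 1 := by
    change ∫ x, ((c⁻¹ * g x : ℝ) : ℂ) ∂haar Γ = 1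
    rw [integral_complex_ofReal, integral_const_mul, ← hc, inv_mul_cancel₀ hpos.ne']
    simp
  have hGn : ∫ x, ‖G x‖ ∂haar Γ = 1 := by
    have : ∀ x, ‖G x‖ = c⁻¹ * g x := fun x => by
      change ‖((c⁻¹ * g x : ℝ) : ℂ)‖ = _
      rw [Complex.norm_real, Real.norm_of_nonneg (mul_nonneg (inv_nonneg.mpr hpos.le) (hg x).1)]
    simp only [this]
    rw [integral_const_mul, ← hc, inv_mul_cancel₀ hpos.ne']
  have key : ∀ k, ‖(∫ x, φ (x⁻¹ * k) * G x ∂haar Γ) - φ k‖ ≤ ε := by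
    intro k
    have hI : Integrable (fun x => φ (x⁻¹ * k) * G x) (haar Γ) :=
      hint ⟨fun x => φ (x⁻¹ * k) * G x, by fun_prop⟩
    have h1 : φ k = ∫ x, φ k * G x ∂haar Γ := by rw [integral_const_mul, hG1, mul_one]
    rw [h1, ← integral_sub hI ((hint G).const_mul _)]
    calc _ ≤ ∫ x, ε * ‖G x‖ ∂haar Γ := by
          refine norm_integral_le_of_norm_le ((hint G).norm.const_mul ε) (.of_forall fun x => ?_)
          rw [← sub_mul, norm_mul]
          by_cases hx : x ∈ U
          · refine mul_le_mul_of_nonneg_right ?_ (norm_nonneg _)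
            have h2 : dist (leftTranslate x⁻¹ φ) φ < ε := hUs hx
            rw [← dist_eq_norm]
            exact (ContinuousMap.dist_apply_le_dist k).trans h2.le
          · have : G x = 0 := by
              change ((c⁻¹ * g x : ℝ) : ℂ) = 0
              rw [hg0 hx]; simp
            simp [this]
      _ = ε := by rw [integral_const_mul, hGn, mul_one]
  refine ⟨EllInf.mk (fun γ => ∫ x, φ (x⁻¹ * ι Γ γ) * G x ∂haar Γ) (ε + ‖φ‖) fun γ => ?_,
    integral_inv_mul_mem_fourierStieltjes φ G _ fun γ => rfl,
    EllInf.norm_le hε.le fun γ => key _⟩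
  have h2 := key (ι Γ γ)
  have h3 := φ.norm_coe_le_norm (ι Γ γ)
  linarith [norm_sub_norm_le (∫ x, φ (x⁻¹ * ι Γ γ) * G x ∂haar Γ) (φ (ι Γ γ))]

variable {Λ : EllInf Γ →ₗ[ℂ] ℂ}

/-- Invariance on `B(Γ)` passes to uniform limits because `Λ` is a contraction. -/
theorem mean_pullback_leftTranslate (hΛ : IsFourierStieltjesMean Λ)
    (φ : C(BohrCompactification Γ, ℂ)) (γ : Γ) :
    Λ (pullback (leftTranslate (ι Γ γ)⁻¹ φ)) = Λ (pullback φ) := by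
  refine eq_of_forall_dist_le fun ε hε => ?_
  obtain ⟨f, hf, hfφ⟩ := exists_mem_fourierStieltjes_norm_sub_le φ (half_pos hε)
  have h1 : ‖Λ (f - pullback φ)‖ ≤ ε / 2 := (hΛ.isMean.norm_le _).trans hfφ
  have h2 : ‖Λ (EllInf.translate γ f - pullback (leftTranslate (ι Γ γ)⁻¹ φ))‖ ≤ ε / 2 := by
    refine (hΛ.isMean.norm_le _).trans (EllInf.norm_le (half_pos hε).le fun x => ?_)
    have h3 := ((f - pullback φ).norm_apply_le (γ⁻¹ * x)).trans hfφ
    simpa [EllInf.translate] using h3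
  rw [map_sub, hΛ.left_invariant f hf] at h2
  rw [map_sub] at h1
  rw [dist_eq_norm]
  calc _ = ‖(Λ f - Λ (pullback φ)) - (Λ f - Λ (pullback (leftTranslate (ι Γ γ)⁻¹ φ)))‖ := by
        rw [sub_sub_sub_cancel_left]
    _ ≤ ε / 2 + ε / 2 := (norm_sub_le _ _).trans (add_le_add h1 h2)
    _ = ε := add_halves ε

/-- A Fourier–Stieltjes mean restricts to the Haar integral on `C(bΓ)`. -/
theorem mean_pullback_eq_integral (hΛ : IsFourierStieltjesMean Λ)
    (φ : C(BohrCompactification Γ, ℂ)) : Λ (pullback φ) = ∫ k, φ k ∂haar Γ := by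
  let ℓ : C(BohrCompactification Γ, ℂ) →L[ℂ] ℂ := (Λ ∘ₗ pullback).mkContinuous 1 fun φ => by
    rw [one_mul]
    exact (hΛ.isMean.norm_le _).trans (norm_pullback_le φ)
  have hℓ : ∀ φ, ℓ φ = Λ (pullback φ) := fun _ => rfl
  have hconst : ∀ k, ℓ (leftTranslate k φ) = ℓ φ := by
    have : (fun k => ℓ (leftTranslate k φ)) = fun _ => ℓ φ := by
      refine (denseRange_ι Γ).equalizer (ℓ.continuous.comp (continuous_leftTranslate φ))
        continuous_const (funext fun γ => ?_)
      have h := mean_pullback_leftTranslate hΛ φ γ⁻¹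
      rwa [map_inv, inv_inv] at h
    exact congrFun this
  have hint : Integrable (fun k => leftTranslate k φ) (haar Γ) :=
    (continuous_leftTranslate φ).integrable_of_hasCompactSupport
      (HasCompactSupport.of_compactSpace _)
  -- The Haar average of all translates, as a Bochner integral in `C(bΓ)`, is a constant function by
  -- right invariance. Applying `ℓ`, constant along translates, identifies its value.
  have hval : ∫ k, leftTranslate k φ ∂haar Γ = (∫ k, φ k ∂haar Γ) • 1 := by
    ext x
    rw [ContinuousMap.integral_apply hint]
    simp only [leftTranslate_apply, ContinuousMap.smul_apply, ContinuousMap.one_apply, smul_eq_mul,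
      mul_one]
    exact integral_mul_right_eq_self (fun k => φ k) x
  have h1 : ∫ k, ℓ (leftTranslate k φ) ∂haar Γ = ℓ (∫ k, leftTranslate k φ ∂haar Γ) :=
    ℓ.integral_comp_comm hint
  have h2 : Λ (pullback 1) = 1 := hΛ.isMean.map_one
  simp only [hconst, hval, map_smul, integral_const, probReal_univ, one_smul] at h1
  rw [← hℓ, h1, hℓ, h2, smul_eq_mul, mul_one]

end BohrCompactification

/-! ### Comparison of measures -/

section Auxiliary

theorem EllInf.chi_mul_nonneg {Γ : Type u} (A : Set Γ) {f : EllInf Γ}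
    (hf : ∀ γ ∈ A, 0 ≤ f γ) (γ : Γ) :
    0 ≤ (EllInf.chi A * f) γ := by
  by_cases h : γ ∈ A
  · simpa [EllInf.chi, h] using hf γ h
  · simp [EllInf.chi, h]

/-- The density integrates over each `s` to at most `μ s ≤ c * ν s`, which forces it below `c`
almost everywhere. -/
theorem eLpNorm_rnDeriv_le_of_le_smul {X : Type u} [MeasurableSpace X] {μ ν : Measure X}
    [IsFiniteMeasure μ] [IsFiniteMeasure ν] {c : ℝ≥0∞} (h : μ ≤ c • ν) :
    eLpNorm (μ.rnDeriv ν) ∞ ν ≤ c := by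
  rw [eLpNorm_exponent_top]
  refine essSup_le_of_ae_le _ ?_
  simp only [enorm_eq_self]
  refine ae_le_of_forall_setLIntegral_le_of_sigmaFinite (Measure.measurable_rnDeriv _ _) ?_
  intro s hs _
  rw [setLIntegral_const]
  exact (Measure.setLIntegral_rnDeriv_le s).trans (h s)

/-- Comparison of regular measures on a compact space through nonnegative continuous functions. -/
theorem measure_le_of_forall_integral_le {X : Type u} [TopologicalSpace X] [CompactSpace X]
    [T2Space X] [MeasurableSpace X] [BorelSpace X] {μ ν : Measure X} [μ.Regular] [ν.Regular]
    (h : ∀ φ : C(X, ℝ), (∀ x, 0 ≤ φ x) → ∫ x, φ x ∂μ ≤ ∫ x, φ x ∂ν) : μ ≤ ν := by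
  have hopen : ∀ V, IsOpen V → μ V ≤ ν V := by
    intro V hV
    rw [hV.measure_eq_iSup_isCompact]
    refine iSup₂_le fun K hKV => iSup_le fun hK => ?_
    -- Urysohn gives `χ_K ≤ φ ≤ χ_V`.
    obtain ⟨φ, hφ0, hφ1, hφ⟩ := exists_continuous_zero_one_of_isClosed hV.isClosed_compl
      hK.isClosed (Set.disjoint_left.mpr fun x hx hxK => hx (hKV hxK))
    have hint : ∀ (m : Measure X) [m.Regular], Integrable φ m := fun m _ =>
      φ.continuous.integrable_of_hasCompactSupport (HasCompactSupport.of_compactSpace _)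
    have hlint : ∀ (m : Measure X) [m.Regular],
        ∫⁻ x, ENNReal.ofReal (φ x) ∂m = ENNReal.ofReal (∫ x, φ x ∂m) := fun m _ =>
      (ofReal_integral_eq_lintegral_ofReal (hint m) (.of_forall fun x => (hφ x).1)).symm
    calc μ K = ∫⁻ x, K.indicator 1 x ∂μ := (lintegral_indicator_one hK.measurableSet).symm
      _ ≤ ∫⁻ x, ENNReal.ofReal (φ x) ∂μ := lintegral_mono fun x => by
          by_cases hx : x ∈ K
          · simp [hx, hφ1 hx]
          · simp [hx]
      _ ≤ ∫⁻ x, ENNReal.ofReal (φ x) ∂ν := by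
          rw [hlint, hlint]
          exact ENNReal.ofReal_le_ofReal (h φ fun x => (hφ x).1)
      _ ≤ ∫⁻ x, V.indicator 1 x ∂ν := lintegral_mono fun x => by
          by_cases hx : x ∈ V
          · simpa [hx] using (hφ x).2
          · simp [hφ0 hx]
      _ = ν V := lintegral_indicator_one hV.measurableSet
  refine Measure.le_intro fun s _ _ => ?_
  rw [s.measure_eq_iInf_isOpen ν]
  exact le_iInf₂ fun V hsV => le_iInf fun hV => (measure_mono hsV).trans (hopen V hV)

end Auxiliary

/-! ### The measure `μ_A` -/

namespace BohrCompactification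

variable {Γ : Type u} [Group Γ]

open CompactlySupported

/-- The bounded function on `Γ` induced by a continuous real function on `bΓ`. -/
noncomputable def realPullback (φ : C(BohrCompactification Γ, ℝ)) : EllInf Γ :=
  pullback ⟨fun x => (φ x : ℂ), by fun_prop⟩

@[simp]
theorem realPullback_apply (φ : C(BohrCompactification Γ, ℝ)) (γ : Γ) :
    realPullback φ γ = (φ (ι Γ γ) : ℂ) := rfl

variable {Λ : EllInf Γ →ₗ[ℂ] ℂ}

theorem mean_realPullback_eq_integral (hΛ : IsFourierStieltjesMean Λ)
    (φ : C(BohrCompactification Γ, ℝ)) :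
    Λ (realPullback φ) = ((∫ k, φ k ∂haar Γ : ℝ) : ℂ) :=
  (mean_pullback_eq_integral hΛ _).trans integral_complex_ofReal

/-- The functional `φ ↦ α⁻¹ ∫_A φ ∘ ι dλ` on continuous functions on `bΓ`. -/
noncomputable def conditionalFunctional (hΛ : IsMean Λ) (A : Set Γ) {α : ℝ} (hα : 0 < α) :
    C_c(BohrCompactification Γ, ℝ) →ₚ[ℝ] ℝ :=
  PositiveLinearMap.mk₀
    { toFun φ := α⁻¹ * (Λ (EllInf.chi A * realPullback φ.toContinuousMap)).re
      map_add' φ ψ := by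
        have : realPullback (φ + ψ).toContinuousMap =
            realPullback φ.toContinuousMap + realPullback ψ.toContinuousMap :=
          EllInf.ext fun γ => by simp
        rw [this, mul_add, map_add, Complex.add_re, mul_add]
      map_smul' c φ := by
        have : realPullback (c • φ).toContinuousMap =
            (c : ℂ) • realPullback φ.toContinuousMap :=
          EllInf.ext fun γ => by
            rw [EllInf.smul_apply]
            simp
        rw [this, mul_smul_comm, map_smul, smul_eq_mul, Complex.re_ofReal_mul]
        simp only [RingHom.id_apply, smul_eq_mul]
        ring }
    fun φ hφ => mul_nonneg (inv_nonneg.mpr hα.le) <| hΛ.re_nonneg <|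
      EllInf.chi_mul_nonneg A fun γ _ => by simpa using hφ (ι Γ γ)

/-- The normalised restriction of a Fourier–Stieltjes mean to `A` induces a measure on `bΓ`. -/
theorem exists_conditional_measure (hΛ : IsFourierStieltjesMean Λ) (A : Set Γ) (α : ℝ)
    (hA : Λ (EllInf.chi A) = α) (hα : 0 < α) :
    ∃ μ : Measure (BohrCompactification Γ), IsProbabilityMeasure μ ∧ μ.Regular ∧
      μ ≤ ENNReal.ofReal (1 / α) • haar Γ ∧ μ.support ⊆ closure (ι Γ '' A) ∧
      ∀ φ : C(BohrCompactification Γ, ℝ),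
        ((∫ k, φ k ∂μ : ℝ) : ℂ) = 1 / (α : ℂ) * Λ (EllInf.chi A * realPullback φ) := by
  set μ := RealRMK.rieszMeasure (conditionalFunctional hΛ.isMean A hα) with hμ
  have hint : ∀ φ : C(BohrCompactification Γ, ℝ),
      ∫ k, φ k ∂μ = α⁻¹ * (Λ (EllInf.chi A * realPullback φ)).re := fun φ =>
    RealRMK.integral_rieszMeasure (conditionalFunctional hΛ.isMean A hα)
      ⟨φ, HasCompactSupport.of_compactSpace _⟩
  have him : ∀ φ : C(BohrCompactification Γ, ℝ), (Λ (EllInf.chi A * realPullback φ)).im = 0 :=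
    fun φ => hΛ.isMean.im_eq_zero fun γ => by
      by_cases h : γ ∈ A <;> simp [EllInf.chi, h]
  have hreg : μ.Regular := RealRMK.regular_rieszMeasure _
  have hprob : IsProbabilityMeasure μ := by
    have h1 : EllInf.chi A * realPullback 1 = EllInf.chi A := EllInf.ext fun γ => by simp
    have h := hint 1
    rw [h1, hA, Complex.ofReal_re, inv_mul_cancel₀ hα.ne'] at h
    simp only [ContinuousMap.one_apply, integral_const, smul_eq_mul, mul_one] at h
    constructor
    rwa [measureReal_def, ENNReal.toReal_eq_one_iff] at h
  have : Measure.Regular (ENNReal.ofReal (1 / α) • haar Γ) :=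
    Measure.Regular.smul ENNReal.ofReal_ne_top
  have hle : ∀ φ : C(BohrCompactification Γ, ℝ), (∀ k, 0 ≤ φ k) →
      ∫ k, φ k ∂μ ≤ ∫ k, φ k ∂(ENNReal.ofReal (1 / α) • haar Γ) := by
    intro φ hφ
    rw [hint, integral_smul_measure, ENNReal.toReal_ofReal (by positivity), one_div, smul_eq_mul]
    refine mul_le_mul_of_nonneg_left ?_ (inv_nonneg.mpr hα.le)
    -- The function is `(1 - χ_A) · (φ ∘ ι)`, and `λ(φ ∘ ι)` is the Haar integral; this yields the
    -- density bound.
    have h1 := hΛ.isMean.re_nonneg (f := realPullback φ - EllInf.chi A * realPullback φ) fun γ => by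
      by_cases h : γ ∈ A <;> simp [EllInf.chi, h, hφ]
    rw [map_sub, mean_realPullback_eq_integral hΛ, Complex.sub_re, Complex.ofReal_re] at h1
    linarith
  refine ⟨μ, hprob, hreg, ?_, ?_, fun φ => ?_⟩
  · exact measure_le_of_forall_integral_le hle
  · refine Measure.support_subset_of_isClosed isClosed_closure ?_
    -- By inner regularity it suffices that compact sets `K` off the closure are null. A Urysohn
    -- function equal to 1 on `K` and 0 on the closure satisfies `χ_A · (φ ∘ ι) = 0`, so its
    -- `μ`-integral vanishes.
    rw [mem_ae_iff, isClosed_closure.isOpen_compl.measure_eq_iSup_isCompact]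
    simp only [ENNReal.iSup_eq_zero]
    intro K hKA hK
    obtain ⟨φ, hφ0, hφ1, hφ⟩ := exists_continuous_zero_one_of_isClosed
      (isClosed_closure (s := ι Γ '' A)) hK.isClosed
      (Set.disjoint_left.mpr fun x hx hxK => hKA hxK hx)
    have h0 : EllInf.chi A * realPullback φ = 0 := EllInf.ext fun γ => by
      by_cases h : γ ∈ A
      · have := hφ0 (subset_closure ⟨γ, h, rfl⟩)
        simp [EllInf.chi, h, this]
      · simp [EllInf.chi, h]
    have h1 := hint φ
    rw [h0, map_zero, Complex.zero_re, mul_zero, integral_eq_zero_iff_of_nonneg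
      (fun x => (hφ x).1) (φ.continuous.integrable_of_hasCompactSupport
        (HasCompactSupport.of_compactSpace _))] at h1
    refine measure_mono_null (fun x hx => ?_) h1
    simp [hφ1 hx]
  · rw [hint, ← Complex.re_add_im (Λ _), him]
    simp

end BohrCompactification

/-! ### Almost periodic vectors and the representation of `bΓ` -/

section AlmostPeriodic

open BohrCompactification

variable {Γ : Type u} [Group Γ] {H : Type v} [NormedAddCommGroup H] [InnerProductSpace ℂ H]
  [CompleteSpace H]

theorem BohrCompactification.continuousMap_ext {Y : Type*} [TopologicalSpace Y] [T2Space Y]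
    {F G : C(BohrCompactification Γ, Y)} (h : ∀ γ, F (ι Γ γ) = G (ι Γ γ)) : F = G :=
  DFunLike.coe_injective <|
    (denseRange_ι Γ).equalizer F.continuous G.continuous (funext h)

/-- `F` is the continuous extension to `bΓ` of the orbit map of `x`. -/
def IsOrbitExtension (π : Γ →* unitary (H →L[ℂ] H)) (x : H)
    (F : C(BohrCompactification Γ, H)) : Prop :=
  ∀ γ, F (ι Γ γ) = (π γ : H →L[ℂ] H) x

namespace IsOrbitExtension

variable {π : Γ →* unitary (H →L[ℂ] H)} {x y : H} {F G : C(BohrCompactification Γ, H)}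

theorem unique (hF : IsOrbitExtension π x F) (hG : IsOrbitExtension π x G) : F = G :=
  continuousMap_ext fun γ => (hF γ).trans (hG γ).symm

theorem add (hF : IsOrbitExtension π x F) (hG : IsOrbitExtension π y G) :
    IsOrbitExtension π (x + y) (F + G) := fun γ => by simp [hF γ, hG γ]

theorem sub (hF : IsOrbitExtension π x F) (hG : IsOrbitExtension π y G) :
    IsOrbitExtension π (x - y) (F - G) := fun γ => by simp [hF γ, hG γ]

theorem smul (c : ℂ) (hF : IsOrbitExtension π x F) :
    IsOrbitExtension π (c • x) (c • F) := fun γ => by simp [hF γ]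

theorem apply_one (hF : IsOrbitExtension π x F) : F 1 = x := by
  simpa using hF 1

theorem norm_apply (hF : IsOrbitExtension π x F) (k : BohrCompactification Γ) : ‖F k‖ = ‖x‖ :=
  congrFun ((denseRange_ι Γ).equalizer F.continuous.norm continuous_const
    (funext fun γ => by simp [hF γ])) k

theorem norm_le (hF : IsOrbitExtension π x F) : ‖F‖ ≤ ‖x‖ :=
  (ContinuousMap.norm_le _ (norm_nonneg _)).mpr fun k => (hF.norm_apply k).le

/-- The identity `F(ι(γ)k) = π(γ)F(k)` holds for `k` in the dense image of `Γ`, hence everywhere. It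
keeps `F k` almost periodic and makes the `bΓ`-action multiplicative. -/
theorem translate (hF : IsOrbitExtension π x F) (k : BohrCompactification Γ) :
    IsOrbitExtension π (F k) (F.comp ⟨fun g => g * k, by fun_prop⟩) := by
  intro γ
  have h : (F.comp ⟨fun k => ι Γ γ * k, by fun_prop⟩ : C(BohrCompactification Γ, H)) =
      (ContinuousMap.mk (π γ : H →L[ℂ] H)).comp F :=
    continuousMap_ext fun δ => by
      change F (ι Γ γ * ι Γ δ) = (π γ : H →L[ℂ] H) (F (ι Γ δ))
      rw [← map_mul, hF, hF, unitaryRep_mul_apply]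
  exact DFunLike.congr_fun h k

end IsOrbitExtension

/-- The closed subspace of vectors whose orbit map extends continuously to `bΓ`. -/
def almostPeriodicVectors (π : Γ →* unitary (H →L[ℂ] H)) : Submodule ℂ H where
  carrier := {x | ∃ F, IsOrbitExtension π x F}
  add_mem' := fun ⟨_, hF⟩ ⟨_, hG⟩ => ⟨_, hF.add hG⟩
  zero_mem' := ⟨0, fun γ => by simp⟩
  smul_mem' := fun c _ ⟨_, hF⟩ => ⟨_, hF.smul c⟩

variable (π : Γ →* unitary (H →L[ℂ] H))

theorem mem_almostPeriodicVectors {x : H} :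
    x ∈ almostPeriodicVectors π ↔ ∃ F, IsOrbitExtension π x F := Iff.rfl

/-- Passing from a vector to its extension does not increase norms, so extensions of a convergent
sequence are Cauchy in `C(bΓ, H)`. -/
theorem isClosed_almostPeriodicVectors : IsClosed (almostPeriodicVectors π : Set H) := by
  refine IsSeqClosed.isClosed fun x a hx hxa => ?_
  choose F hF using hx
  have hcauchy : CauchySeq F := by
    refine Metric.cauchySeq_iff.mpr fun ε hε => ?_
    obtain ⟨N, hN⟩ := Metric.cauchySeq_iff.mp hxa.cauchySeq ε hε
    refine ⟨N, fun m hm n hn => lt_of_le_of_lt ?_ (hN m hm n hn)⟩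
    rw [dist_eq_norm, dist_eq_norm]
    exact ((hF m).sub (hF n)).norm_le
  obtain ⟨G, hG⟩ := cauchySeq_tendsto_of_complete hcauchy
  refine ⟨G, fun γ => ?_⟩
  have h1 : Filter.Tendsto (fun n => F n (ι Γ γ)) Filter.atTop (𝓝 (G (ι Γ γ))) :=
    ((continuous_eval_const (ι Γ γ)).tendsto G).comp hG
  have h2 : Filter.Tendsto (fun n => F n (ι Γ γ)) Filter.atTop (𝓝 ((π γ : H →L[ℂ] H) a)) := by
    simp only [hF _ γ]
    exact ((π γ : H →L[ℂ] H).continuous.tendsto a).comp hxa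
  exact tendsto_nhds_unique h1 h2

instance : CompleteSpace (almostPeriodicVectors π) :=
  (isClosed_almostPeriodicVectors π).completeSpace_coe

theorem map_mem_almostPeriodicVectors {x : H} (hx : x ∈ almostPeriodicVectors π) (γ : Γ) :
    (π γ : H →L[ℂ] H) x ∈ almostPeriodicVectors π := by
  obtain ⟨F, hF⟩ := hx
  exact ⟨_, hF γ ▸ hF.translate (ι Γ γ)⟩

theorem fixedVectors_le_almostPeriodicVectors : fixedVectors π ≤ almostPeriodicVectors π :=
  fun x hx => ⟨ContinuousMap.const _ x, fun γ => (hx γ).symm⟩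

/-- The continuous extension to `bΓ` of the orbit map of an almost periodic vector. -/
noncomputable def orbitExtension (x : almostPeriodicVectors π) : C(BohrCompactification Γ, H) :=
  Classical.choose ((mem_almostPeriodicVectors π).mp x.2)

theorem isOrbitExtension_orbitExtension (x : almostPeriodicVectors π) :
    IsOrbitExtension π x (orbitExtension π x) :=
  Classical.choose_spec ((mem_almostPeriodicVectors π).mp x.2)

/-- The action of an element of `bΓ` on the almost periodic vectors. -/
noncomputable def almostPeriodicOp (k : BohrCompactification Γ) :
    almostPeriodicVectors π →L[ℂ] almostPeriodicVectors π :=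
  LinearMap.mkContinuous
    { toFun x := ⟨orbitExtension π x k, _, (isOrbitExtension_orbitExtension π x).translate k⟩
      map_add' x y := Subtype.ext <| DFunLike.congr_fun
        ((isOrbitExtension_orbitExtension π (x + y)).unique
          ((isOrbitExtension_orbitExtension π x).add (isOrbitExtension_orbitExtension π y))) k
      map_smul' c x := Subtype.ext <| DFunLike.congr_fun
        ((isOrbitExtension_orbitExtension π (c • x)).unique
          ((isOrbitExtension_orbitExtension π x).smul c)) k }
    1 fun x => by
      rw [one_mul]
      exact ((isOrbitExtension_orbitExtension π x).norm_apply k).le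

/-- The unitary representation of `bΓ` on the almost periodic vectors of `π`. -/
noncomputable def almostPeriodicRep :
    BohrCompactification Γ →*
      unitary (almostPeriodicVectors π →L[ℂ] almostPeriodicVectors π) :=
  unitaryRepOfIsometry
    { toFun := almostPeriodicOp π
      map_one' := by
        ext x
        exact (isOrbitExtension_orbitExtension π x).apply_one
      map_mul' k l := by
        ext x
        exact (DFunLike.congr_fun ((isOrbitExtension_orbitExtension π
          (almostPeriodicOp π l x)).unique
            ((isOrbitExtension_orbitExtension π x).translate l)) k).symm }
    fun k x => (isOrbitExtension_orbitExtension π x).norm_apply k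

theorem coe_almostPeriodicRep_ι (γ : Γ) (x : almostPeriodicVectors π) :
    ((almostPeriodicRep π (ι Γ γ) :
      almostPeriodicVectors π →L[ℂ] almostPeriodicVectors π) x : H) = (π γ : H →L[ℂ] H) x :=
  isOrbitExtension_orbitExtension π x γ

theorem stronglyContinuous_almostPeriodicRep : StronglyContinuous (almostPeriodicRep π) :=
  fun x => Continuous.subtype_mk (orbitExtension π x).continuous _

theorem compactSpace_unitary_of_finiteDimensional (E : Type w) [NormedAddCommGroup E]
    [InnerProductSpace ℂ E] [CompleteSpace E] [FiniteDimensional ℂ E] :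
    CompactSpace (unitary (E →L[ℂ] E)) := by
  have : ProperSpace (E →L[ℂ] E) := FiniteDimensional.proper ℂ (E →L[ℂ] E)
  have h : IsCompact (unitary (E →L[ℂ] E) : Set (E →L[ℂ] E)) := by
    refine Metric.isCompact_of_isClosed_isBounded isClosed_unitary ?_
    refine (Metric.isBounded_closedBall (x := 0) (r := 1)).subset fun U hU => ?_
    rw [mem_closedBall_zero_iff]
    refine ContinuousLinearMap.opNorm_le_bound _ zero_le_one fun x => ?_
    rw [one_mul]
    exact (Unitary.norm_map ⟨U, hU⟩ x).le
  exact isCompact_iff_compactSpace.mp h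

/-- The finite-dimensional unitary group is compact Hausdorff, so `τ` itself extends to `bΓ` by the
universal property. -/
theorem almostPeriodicVectors_eq_top_of_finiteDimensional {E : Type w} [NormedAddCommGroup E]
    [InnerProductSpace ℂ E] [CompleteSpace E] [FiniteDimensional ℂ E]
    (τ : Γ →* unitary (E →L[ℂ] E)) : almostPeriodicVectors τ = ⊤ := by
  have := compactSpace_unitary_of_finiteDimensional E
  obtain ⟨φ, hφ, -⟩ := existsUnique_lift Γ τ
  refine eq_top_iff.mpr fun x _ => ⟨⟨fun k => (φ k : E →L[ℂ] E) x, ?_⟩, fun γ => ?_⟩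
  · have h : Continuous fun k => (φ k : E →L[ℂ] E) :=
      continuous_subtype_val.comp φ.continuous_toFun
    exact h.clm_apply continuous_const
  · change (φ (ι Γ γ) : E →L[ℂ] E) x = _
    rw [hφ]

/-- Finite-dimensional invariant subspaces consist of almost periodic vectors. -/
theorem le_almostPeriodicVectors_of_finiteDimensional (W : Submodule ℂ H) [FiniteDimensional ℂ W]
    (hW : ∀ γ, ∀ x ∈ W, (π γ : H →L[ℂ] H) x ∈ W) : W ≤ almostPeriodicVectors π := by
  have : CompleteSpace W := FiniteDimensional.complete ℂ W
  let ρ : Γ →* (W →L[ℂ] W) :=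
    { toFun γ := (π γ : H →L[ℂ] H).restrict (hW γ)
      map_one' := by ext x; simp
      map_mul' γ δ := by
        ext x
        exact unitaryRep_mul_apply π γ δ x }
  let τ := unitaryRepOfIsometry ρ fun γ x => unitaryRep_norm_apply π γ (x : H)
  intro x hx
  have h : (⟨x, hx⟩ : W) ∈ almostPeriodicVectors τ := by
    rw [almostPeriodicVectors_eq_top_of_finiteDimensional]
    trivial
  obtain ⟨F, hF⟩ := h
  exact ⟨⟨fun k => F k, by fun_prop⟩, fun γ => congrArg Subtype.val (hF γ)⟩

end AlmostPeriodic

/-! ### Positive operators of finite trace -/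

section TraceClass

variable {H : Type v} [NormedAddCommGroup H] [InnerProductSpace ℂ H]

/-- The pre-inner product `⟨T x, y⟩` of a positive operator. -/
noncomputable abbrev ContinuousLinearMap.IsPositive.innerCore {T : H →L[ℂ] H}
    (hT : T.IsPositive) : PreInnerProductSpace.Core ℂ H where
  inner x y := inner ℂ (T x) y
  conj_inner_symm x y := (inner_conj_symm _ _).trans (hT.1 x y).symm
  re_inner_nonneg x := hT.2 x
  add_left x y z := by
    change inner ℂ (T (x + y)) z = inner ℂ (T x) z + inner ℂ (T y) z
    rw [map_add, inner_add_left]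
  smul_left x y r := by
    change inner ℂ (T (r • x)) y = _ * inner ℂ (T x) y
    rw [map_smul, inner_smul_left]

theorem ContinuousLinearMap.IsPositive.norm_inner_sq_le {T : H →L[ℂ] H} (hT : T.IsPositive)
    (x y : H) :
    ‖inner ℂ (T x) y‖ ^ 2 ≤ (inner ℂ (T x) x : ℂ).re * (inner ℂ (T y) y : ℂ).re := by
  have h := @InnerProductSpace.Core.inner_mul_inner_self_le ℂ H _ _ _ hT.innerCore x y
  have h2 : ‖inner ℂ (T y) x‖ = ‖inner ℂ (T x) y‖ := by
    rw [norm_inner_symm]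
    exact congrArg norm (hT.1 x y).symm
  rw [sq]
  nth_rw 2 [← h2]
  exact h

/-- Cauchy–Schwarz for the form `⟨T·, ·⟩` at `x` and `T x`, then cancel `‖T x‖²`. -/
theorem ContinuousLinearMap.IsPositive.norm_apply_sq_le {T : H →L[ℂ] H} (hT : T.IsPositive)
    (x : H) : ‖T x‖ ^ 2 ≤ ‖T‖ * (inner ℂ (T x) x : ℂ).re := by
  have h := hT.norm_inner_sq_le x (T x)
  have h1 : (inner ℂ (T (T x)) (T x) : ℂ).re ≤ ‖T‖ * ‖T x‖ ^ 2 := by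
    refine (Complex.re_le_norm _).trans ((norm_inner_le_norm _ _).trans ?_)
    rw [sq, ← mul_assoc]
    exact mul_le_mul_of_nonneg_right (T.le_opNorm _) (norm_nonneg _)
  have h0 : 0 ≤ (inner ℂ (T x) x : ℂ).re := hT.2 x
  rw [inner_self_eq_norm_sq_to_K, norm_pow, RCLike.norm_ofReal, abs_norm] at h
  rcases eq_or_ne (‖T x‖) 0 with hz | hz
  · rw [hz, zero_pow two_ne_zero]
    exact mul_nonneg (norm_nonneg _) h0
  · have hp : 0 < ‖T x‖ ^ 2 := by positivity
    refine le_of_mul_le_mul_right ?_ hp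
    nlinarith [mul_le_mul_of_nonneg_left h1 h0]

/-- A positive operator of finite trace is compact. -/
theorem ContinuousLinearMap.IsPositive.isCompactOperator_of_trace_le [CompleteSpace H]
    {T : H →L[ℂ] H} (hT : T.IsPositive) {C : ℝ}
    (hC : ∀ s : Finset H, Orthonormal ℂ (Subtype.val : ↥(s : Set H) → H) →
      ∑ x ∈ s, (inner ℂ (T x) x : ℂ).re ≤ C) : IsCompactOperator T := by
  classical
  let S : Set ℝ := {r | ∃ s : Finset H, Orthonormal ℂ (Subtype.val : ↥(s : Set H) → H) ∧
    r = ∑ x ∈ s, (inner ℂ (T x) x : ℂ).re}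
  have hSne : S.Nonempty := ⟨0, ∅, by simp, by simp⟩
  have hSb : BddAbove S := ⟨C, by rintro _ ⟨s, hs, rfl⟩; exact hC s hs⟩
  suffices h : T ∈ closure {f : H →L[ℂ] H | IsCompactOperator f} by
    rwa [isClosed_setOfPred_isCompactOperator.closure_eq] at h
  refine Metric.mem_closure_iff.mpr fun ε hε => ?_
  -- Chosen so that `‖T‖ * δ ≤ (ε / 2) ^ 2`; the `+ 1` covers `T = 0`.
  set δ : ℝ := (ε / 2) ^ 2 / (‖T‖ + 1) with hδ
  have hT1 : 0 < ‖T‖ + 1 := by positivity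
  have hδ0 : 0 < δ := by positivity
  obtain ⟨_, ⟨s, hs, rfl⟩, hsδ⟩ := exists_lt_of_lt_csSup hSne (sub_lt_self (sSup S) hδ0)
  let F : Submodule ℂ H := Submodule.span ℂ (s : Set H)
  have : FiniteDimensional ℂ F := FiniteDimensional.span_finset ℂ s
  have : ProperSpace F := FiniteDimensional.proper ℂ F
  -- The partial trace over `s` is within `δ` of the supremum, so adjoining `w` can add at most `δ`.
  have hunit : ∀ w ∈ Fᗮ, ‖w‖ = 1 → (inner ℂ (T w) w : ℂ).re ≤ δ := by
    intro w hw hw1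
    have hws : ∀ x ∈ s, inner ℂ x w = 0 := fun x hx =>
      Submodule.inner_right_of_mem_orthogonal (Submodule.subset_span hx) hw
    have hww : inner ℂ w w = (1 : ℂ) := by
      rw [inner_self_eq_norm_sq_to_K, hw1]; simp
    have hnot : w ∉ s := fun h => by
      rw [hws w h] at hww
      exact zero_ne_one hww
    have hins : Orthonormal ℂ (Subtype.val : ↥((insert w s : Finset H) : Set H) → H) := by
      have h1 := orthonormal_subtype_iff_ite.mp hs
      refine orthonormal_subtype_iff_ite.mpr fun a ha b hb => ?_
      rcases Finset.mem_insert.mp ha with rfl | ha' <;> rcases Finset.mem_insert.mp hb with rfl | hb'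
      · simpa using hww
      · rw [if_neg (ne_of_mem_of_not_mem hb' hnot).symm, ← inner_conj_symm, hws b hb', map_zero]
      · rw [if_neg (ne_of_mem_of_not_mem ha' hnot), hws a ha']
      · exact h1 a ha' b hb'
    have h2 := le_csSup hSb ⟨insert w s, hins, rfl⟩
    rw [Finset.sum_insert hnot] at h2
    linarith
  have hbound : ∀ w ∈ Fᗮ, ‖T w‖ ≤ ε / 2 * ‖w‖ := by
    intro w hw
    rcases eq_or_ne w 0 with rfl | hw0
    · simp
    have hn : 0 < ‖w‖ := norm_pos_iff.mpr hw0
    set e : H := ((‖w‖⁻¹ : ℝ) : ℂ) • w with he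
    have he1 : ‖e‖ = 1 := by
      rw [he, norm_smul, Complex.norm_real, norm_inv, norm_norm, inv_mul_cancel₀ hn.ne']
    have h3 : ‖T e‖ ^ 2 ≤ (ε / 2) ^ 2 := by
      refine (hT.norm_apply_sq_le e).trans ?_
      calc _ ≤ ‖T‖ * δ := mul_le_mul_of_nonneg_left (hunit e (Fᗮ.smul_mem _ hw) he1) (norm_nonneg _)
        _ ≤ (‖T‖ + 1) * δ := by nlinarith
        _ = (ε / 2) ^ 2 := by rw [hδ]; field_simp
    have h4 : ‖T e‖ ≤ ε / 2 := le_of_sq_le_sq h3 (by positivity)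
    rw [he, map_smul, norm_smul, Complex.norm_real, norm_inv, norm_norm, inv_mul_le_iff₀ hn] at h4
    linarith
  -- The approximant has finite rank, and its error is `T` applied to the component in `Fᗮ`,
  -- controlled by `hbound`.
  refine ⟨T ∘L F.subtypeL ∘L F.orthogonalProjectionOnto, ?_, ?_⟩
  · have h : IsCompactOperator (T ∘L F.subtypeL) :=
      isCompactOperator_of_locallyCompactSpace_rng _
    exact h.comp_clm F.orthogonalProjectionOnto
  · rw [dist_eq_norm]
    refine lt_of_le_of_lt (ContinuousLinearMap.opNorm_le_bound _ (half_pos hε).le fun x => ?_)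
      (half_lt_self hε)
    have h5 : (T - T ∘L F.subtypeL ∘L F.orthogonalProjectionOnto) x =
        T (x - F.orthogonalProjectionOnto x) := by
      rw [map_sub]; rfl
    rw [h5]
    refine (hbound _ (F.sub_starProjection_mem_orthogonal x)).trans ?_
    refine mul_le_mul_of_nonneg_left ?_ (half_pos hε).le
    have := Fᗮ.norm_starProjection_apply_le x
    rwa [Submodule.starProjection_orthogonal_val] at this

end TraceClass

/-! ### Vanishing on the orthogonal complement -/

section WeakMixing

open BohrCompactification

variable {Γ : Type u} [Group Γ] {H : Type v} [NormedAddCommGroup H] [InnerProductSpace ℂ H]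
  [CompleteSpace H] (π : Γ →* unitary (H →L[ℂ] H))

/-- The bounded functions `γ ↦ ⟨π(γ)x, w⟩`, linearly in `w`. -/
noncomputable def orbitCoeff (x : H) : H →ₗ[ℂ] EllInf Γ where
  toFun w := EllInf.mk (fun γ => inner ℂ ((π γ : H →L[ℂ] H) x) w) (‖x‖ * ‖w‖) fun γ =>
    (norm_inner_le_norm _ _).trans_eq (by rw [unitaryRep_norm_apply])
  map_add' _ _ := EllInf.ext fun _ => inner_add_right _ _ _
  map_smul' _ _ := EllInf.ext fun _ => inner_smul_right _ _ _

@[simp]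
theorem orbitCoeff_apply (x w : H) (γ : Γ) :
    orbitCoeff π x w γ = inner ℂ ((π γ : H →L[ℂ] H) x) w := rfl

theorem norm_orbitCoeff_le (x w : H) : ‖orbitCoeff π x w‖ ≤ ‖x‖ * ‖w‖ :=
  EllInf.norm_le (by positivity) fun γ =>
    (norm_inner_le_norm _ _).trans_eq (by rw [unitaryRep_norm_apply])

theorem star_orbitCoeff_mul_mem_fourierStieltjes (x w₁ w₂ : H) :
    star (orbitCoeff π x w₁) * orbitCoeff π x w₂ ∈ fourierStieltjes Γ :=
  mul_coeff_mem_fourierStieltjes π x w₁ w₂ _ fun γ => by simp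

variable {Λ : EllInf Γ →ₗ[ℂ] ℂ}

/-- The sesquilinear form `(w₁, w₂) ↦ ∫ ⟨w₁, π(γ)x⟩ ⟨π(γ)x, w₂⟩ dλ(γ)`. -/
noncomputable def meanForm (hΛ : IsMean Λ) (x : H) : H →L⋆[ℂ] H →L[ℂ] ℂ :=
  LinearMap.mkContinuous₂
    (LinearMap.mk₂'ₛₗ (starRingEnd ℂ) (RingHom.id ℂ)
      (fun w₁ w₂ => Λ (star (orbitCoeff π x w₁) * orbitCoeff π x w₂))
      (fun a b c => by rw [map_add, star_add, add_mul, map_add])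
      (fun r a b => by rw [map_smul, star_smul, smul_mul_assoc, map_smul]; rfl)
      (fun a b c => by rw [map_add, mul_add, map_add])
      (fun r a b => by rw [map_smul, mul_smul_comm, map_smul]; rfl))
    (‖x‖ * ‖x‖) fun a b => by
      refine (hΛ.norm_le _).trans ((norm_mul_le _ _).trans ?_)
      rw [norm_star]
      refine (mul_le_mul (norm_orbitCoeff_le π x a) (norm_orbitCoeff_le π x b) (norm_nonneg _)
        (by positivity)).trans_eq (by ring)

/-- The positive operator representing `meanForm`. -/
noncomputable def meanOp (hΛ : IsMean Λ) (x : H) : H →L[ℂ] H :=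
  InnerProductSpace.continuousLinearMapOfBilin (meanForm π hΛ x)

theorem inner_meanOp (hΛ : IsMean Λ) (x w₁ w₂ : H) :
    inner ℂ (meanOp π hΛ x w₁) w₂ = Λ (star (orbitCoeff π x w₁) * orbitCoeff π x w₂) :=
  InnerProductSpace.continuousLinearMapOfBilin_apply _ _ _

theorem isPositive_meanOp (hΛ : IsMean Λ) (x : H) : (meanOp π hΛ x).IsPositive := by
  refine ⟨fun a b => ?_, fun a => ?_⟩
  · rw [← inner_conj_symm a]
    change inner ℂ (meanOp π hΛ x a) b = star (inner ℂ (meanOp π hΛ x b) a)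
    rw [inner_meanOp, inner_meanOp, ← hΛ.map_star, EllInf.star_star_mul]
  · change 0 ≤ (inner ℂ (meanOp π hΛ x a) a : ℂ).re
    rw [inner_meanOp]
    exact hΛ.re_star_mul_self_nonneg _

/-- Bessel's inequality for `π(γ)x`, pointwise in `γ`, survives the mean and bounds the trace by
`‖x‖²`. -/
theorem isCompactOperator_meanOp (hΛ : IsMean Λ) (x : H) : IsCompactOperator (meanOp π hΛ x) := by
  refine (isPositive_meanOp π hΛ x).isCompactOperator_of_trace_le (C := ‖x‖ ^ 2) fun s hs => ?_
  simp only [inner_meanOp]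
  rw [← Complex.re_sum, ← map_sum]
  refine hΛ.re_le_of_le fun γ => ?_
  have h1 := hs.sum_inner_products_le (x := (π γ : H →L[ℂ] H) x) (s := Finset.univ)
  rw [unitaryRep_norm_apply] at h1
  have h2 : (∑ w ∈ s, star (orbitCoeff π x w) * orbitCoeff π x w : EllInf Γ) γ =
      ((∑ w ∈ s, ‖inner ℂ w ((π γ : H →L[ℂ] H) x)‖ ^ 2 : ℝ) : ℂ) := by
    rw [lp.coeFn_sum, Finset.sum_apply, Complex.ofReal_sum]
    refine Finset.sum_congr rfl fun w _ => ?_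
    rw [EllInf.mul_apply, EllInf.star_apply, orbitCoeff_apply, norm_inner_symm,
      ← starRingEnd_apply, ← Complex.normSq_eq_conj_mul_self, Complex.normSq_eq_norm_sq]
  rw [h2]
  refine Complex.real_le_real.mpr (le_trans (le_of_eq ?_) h1)
  exact (Finset.sum_coe_sort s fun w => ‖inner ℂ w ((π γ : H →L[ℂ] H) x)‖ ^ 2).symm

/-- Moving `π(γ)` across the form translates the integrand, which lies in `B(Γ)`; here left
invariance enters. -/
theorem meanOp_comm (hΛ : IsFourierStieltjesMean Λ) (x w : H) (γ : Γ) :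
    meanOp π hΛ.isMean x ((π γ : H →L[ℂ] H) w) =
      (π γ : H →L[ℂ] H) (meanOp π hΛ.isMean x w) := by
  refine ext_inner_right ℂ fun z => ?_
  have hz : z = (π γ : H →L[ℂ] H) ((π γ⁻¹ : H →L[ℂ] H) z) := by
    rw [← unitaryRep_mul_apply, mul_inv_cancel, unitaryRep_one_apply]
  rw [hz, unitaryRep_inner_apply, inner_meanOp, inner_meanOp,
    ← hΛ.left_invariant _ (star_orbitCoeff_mul_mem_fourierStieltjes π x w _) γ]
  congr 1
  refine EllInf.ext fun δ => ?_
  have hδ : ∀ y, inner ℂ ((π δ : H →L[ℂ] H) x) ((π γ : H →L[ℂ] H) y) =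
      inner ℂ ((π (γ⁻¹ * δ) : H →L[ℂ] H) x) y := fun y => by
    rw [← unitaryRep_inner_apply π γ _ y, ← unitaryRep_mul_apply, mul_inv_cancel_left]
  simp [EllInf.translate, hδ]

theorem map_mem_orthogonal_almostPeriodicVectors {x : H}
    (hx : x ∈ (almostPeriodicVectors π)ᗮ) (γ : Γ) :
    (π γ : H →L[ℂ] H) x ∈ (almostPeriodicVectors π)ᗮ := by
  refine (Submodule.mem_orthogonal _ _).mpr fun y hy => ?_
  rw [← unitaryRep_inner_apply π γ⁻¹, ← unitaryRep_mul_apply π γ⁻¹ γ,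
    inv_mul_cancel, unitaryRep_one_apply]
  exact (Submodule.mem_orthogonal _ _).mp hx _ (map_mem_almostPeriodicVectors π hy _)

theorem meanOp_eq_zero (hΛ : IsFourierStieltjesMean Λ) {x : H}
    (hx : x ∈ (almostPeriodicVectors π)ᗮ) : meanOp π hΛ.isMean x = 0 := by
  set T := meanOp π hΛ.isMean x with hT
  have hcompact := isCompactOperator_meanOp π hΛ.isMean x
  have hker : ∀ w ∈ almostPeriodicVectors π, T w = 0 := by
    intro w hw
    refine ext_inner_right ℂ fun z => ?_
    have h0 : orbitCoeff π x w = 0 := EllInf.ext fun γ => by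
      rw [orbitCoeff_apply]
      exact Submodule.inner_left_of_mem_orthogonal hw
        (map_mem_orthogonal_almostPeriodicVectors π hx γ)
    rw [hT, inner_meanOp, h0, star_zero, zero_mul, map_zero, inner_zero_left]
  -- By the spectral theorem it suffices to exclude nonzero eigenvalues. Such an eigenspace would be
  -- finite-dimensional and `π`-invariant, hence almost periodic, hence inside the kernel of `T`.
  refine (ContinuousLinearMap.eq_zero_of_forall_hasEigenvalue_eq_zero hcompact
    (isPositive_meanOp π hΛ.isMean x).1).mp fun c hc => ?_
  by_contra hc0
  have := ContinuousLinearMap.finite_dimensional_eigenspace hcompact c hc0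
  have hle := le_almostPeriodicVectors_of_finiteDimensional π
    (Module.End.eigenspace (T : H →ₗ[ℂ] H) c) fun γ y hy => by
      rw [Module.End.mem_eigenspace_iff] at hy ⊢
      have hy' : T y = c • y := hy
      change T _ = _
      rw [hT, meanOp_comm π hΛ, ← hT, hy', map_smul]
  obtain ⟨y, hy, hy0⟩ := hc.exists_hasEigenvector
  have h1 : T y = c • y := Module.End.mem_eigenspace_iff.mp hy
  rw [hker y (hle hy)] at h1
  exact smul_ne_zero hc0 hy0 h1.symm

/-- The coefficient has zero mean square, so Cauchy–Schwarz makes it orthogonal to `χ_A`, though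
`χ_A` need not lie in `B(Γ)`. -/
theorem meanIntegral_reCoeff_eq_zero (hΛ : IsFourierStieltjesMean Λ) (A : Set Γ) {x : H}
    (hx : x ∈ (almostPeriodicVectors π)ᗮ) (w : H) :
    meanIntegral Λ A (reCoeff π x w) = 0 := by
  have h1 : Λ (star (orbitCoeff π x w) * orbitCoeff π x w) = 0 := by
    rw [← inner_meanOp π hΛ.isMean, meanOp_eq_zero π hΛ hx]
    exact inner_zero_left _
  have h2 : Λ (EllInf.chi A * orbitCoeff π x w) = 0 := by
    have h := hΛ.isMean.norm_star_mul_sq_le (EllInf.chi A) (orbitCoeff π x w)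
    have hstar : star (EllInf.chi A) = EllInf.chi A := EllInf.ext fun γ => by
      by_cases hγ : γ ∈ A <;> simp [EllInf.chi, hγ]
    rw [h1, Complex.zero_re, mul_zero, hstar] at h
    exact norm_eq_zero.mp (pow_eq_zero_iff two_ne_zero |>.mp (le_antisymm h (sq_nonneg _)))
  have h3 : (2 : ℂ) • (EllInf.chi A * reCoeff π x w) =
      EllInf.chi A * orbitCoeff π x w + star (EllInf.chi A * orbitCoeff π x w) :=
    EllInf.ext fun γ => by
      rw [EllInf.smul_apply]
      by_cases hγ : γ ∈ A
      · simp only [EllInf.mul_apply, EllInf.add_apply, EllInf.star_apply, EllInf.chi,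
          EllInf.mk_apply, Set.indicator_of_mem hγ, reCoeff, orbitCoeff_apply, Pi.one_apply, one_mul]
        refine Eq.trans ?_ (Complex.add_conj _).symm
        push_cast
        rfl
      · simp [EllInf.chi, hγ]
  have h4 := congrArg Λ h3
  rw [map_add, hΛ.isMean.map_star, h2, star_zero, add_zero, map_smul, smul_eq_mul] at h4
  exact (mul_eq_zero.mp h4).resolve_left two_ne_zero

end WeakMixing

/-! ### Reduction to the almost periodic part -/

section Projection

open BohrCompactification

variable {Γ : Type u} [Group Γ] {H : Type v} [NormedAddCommGroup H] [InnerProductSpace ℂ H]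
  [CompleteSpace H] (π : Γ →* unitary (H →L[ℂ] H))

theorem orthogonalProjectionOnto_map (γ : Γ) (x : H) :
    ((almostPeriodicVectors π).orthogonalProjectionOnto ((π γ : H →L[ℂ] H) x) : H) =
      (π γ : H →L[ℂ] H) ((almostPeriodicVectors π).orthogonalProjectionOnto x) := by
  refine Submodule.eq_starProjection_of_mem_orthogonal
    (map_mem_almostPeriodicVectors π (Submodule.coe_mem _) γ) ?_
  rw [← map_sub]
  exact map_mem_orthogonal_almostPeriodicVectors π
    ((almostPeriodicVectors π).sub_starProjection_mem_orthogonal x) γ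

variable {Λ : EllInf Γ →ₗ[ℂ] ℂ}

/-- Only the almost periodic part of a vector contributes to the averaged correlations. -/
theorem meanIntegral_reCoeff_eq (hΛ : IsFourierStieltjesMean Λ) (A : Set Γ) (x : H) (γ : Γ) :
    meanIntegral Λ A (reCoeff π x ((π γ : H →L[ℂ] H) x)) =
      meanIntegral Λ A (reCoeff (almostPeriodicRep π |>.comp (ι Γ))
        ((almostPeriodicVectors π).orthogonalProjectionOnto x)
        ((almostPeriodicRep π (ι Γ γ) : almostPeriodicVectors π →L[ℂ] almostPeriodicVectors π)
          ((almostPeriodicVectors π).orthogonalProjectionOnto x))) := by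
  set p := (almostPeriodicVectors π).orthogonalProjectionOnto x with hp
  set q : H := x - p with hq
  have hqV : q ∈ (almostPeriodicVectors π)ᗮ :=
    (almostPeriodicVectors π).sub_starProjection_mem_orthogonal x
  have hx : x = p + q := by rw [hq]; abel
  have h0 := meanIntegral_reCoeff_eq_zero π hΛ A hqV ((π γ : H →L[ℂ] H) q)
  have hsplit : reCoeff π x ((π γ : H →L[ℂ] H) x) =
      reCoeff (almostPeriodicRep π |>.comp (ι Γ)) p
        ((almostPeriodicRep π (ι Γ γ) : almostPeriodicVectors π →L[ℂ] almostPeriodicVectors π) p) +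
      reCoeff π q ((π γ : H →L[ℂ] H) q) := by
    refine EllInf.ext fun a => ?_
    -- Cross terms vanish pointwise in `a`, since both summands are invariant.
    have h1 : inner ℂ ((π a : H →L[ℂ] H) p) ((π γ : H →L[ℂ] H) q) = (0 : ℂ) :=
      Submodule.inner_right_of_mem_orthogonal
        (map_mem_almostPeriodicVectors π p.2 a)
        (map_mem_orthogonal_almostPeriodicVectors π hqV γ)
    have h2 : inner ℂ ((π a : H →L[ℂ] H) q) ((π γ : H →L[ℂ] H) p) = (0 : ℂ) :=
      Submodule.inner_left_of_mem_orthogonal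
        (map_mem_almostPeriodicVectors π p.2 γ)
        (map_mem_orthogonal_almostPeriodicVectors π hqV a)
    rw [EllInf.add_apply]
    simp only [reCoeff, EllInf.mk_apply, MonoidHom.comp_apply, Submodule.coe_inner,
      coe_almostPeriodicRep_ι]
    rw [← Complex.ofReal_add, ← Complex.add_re]
    congr 2
    conv_lhs => rw [hx]
    rw [map_add, map_add, inner_add_left, inner_add_right, inner_add_right, h1, h2, add_zero,
      zero_add]
  rw [hsplit, meanIntegral, mul_add, map_add]
  change _ + meanIntegral Λ A _ = _
  rw [h0, add_zero]
  rfl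

end Projection

/-! ### Averaged correlations and the conclusion -/

theorem re_inner_averageOp {G : Type u} [Group G] [TopologicalSpace G] [CompactSpace G]
    [T2Space G] [MeasurableSpace G] [BorelSpace G] {V : Type v} [NormedAddCommGroup V]
    [InnerProductSpace ℂ V] [CompleteSpace V] {θ : G →* unitary (V →L[ℂ] V)}
    (hθ : StronglyContinuous θ) (μ : Measure G) [IsFiniteMeasure μ] (x y : V) :
    (inner ℂ (averageOp θ μ x) y : ℂ).re =
      ∫ k, (inner ℂ ((θ k : V →L[ℂ] V) x) y : ℂ).re ∂μ := by
  have hint : Integrable (fun k => (θ k : V →L[ℂ] V) x) μ :=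
    (hθ x).integrable_of_hasCompactSupport (HasCompactSupport.of_compactSpace _)
  have h1 : ∀ z : V, (inner ℂ z y : ℂ).re = (inner ℂ y z : ℂ).re := fun z => by
    rw [← inner_conj_symm, Complex.conj_re]
  simp only [h1]
  rw [averageOp, ← integral_inner (𝕜 := ℂ) hint y]
  exact (integral_re (hint.const_inner (𝕜 := ℂ) y)).symm

theorem proposition3p1 {Γ : Type u} [Group Γ] {H : Type v} [NormedAddCommGroup H]
    [InnerProductSpace ℂ H] [CompleteSpace H] (π : Γ →* unitary (H →L[ℂ] H))
    (Λ : EllInf Γ →ₗ[ℂ] ℂ) (hΛ : IsFourierStieltjesMean Λ)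
    (A : Set Γ) (α : ℝ) (hA : Λ (EllInf.chi A) = α) (hα : 0 < α) :
    ∃ (μ : Measure (BohrCompactification Γ)) (V : Type v) (_ : NormedAddCommGroup V)
      (_ : InnerProductSpace ℂ V) (_ : CompleteSpace V)
      (θ : BohrCompactification Γ →* unitary (V →L[ℂ] V)) (Q : H →L[ℂ] V),
      IsProbabilityMeasure μ ∧ μ.Regular ∧ μ ≪ BohrCompactification.haar Γ ∧
      μ.support ⊆ closure (BohrCompactification.ι Γ '' A) ∧
      eLpNorm (μ.rnDeriv (BohrCompactification.haar Γ)) ∞ (BohrCompactification.haar Γ)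
        ≤ ENNReal.ofReal (1 / α) ∧
      StronglyContinuous θ ∧
      (∀ γ x, Q ((π γ : H →L[ℂ] H) x) =
        (θ (BohrCompactification.ι Γ γ) : V →L[ℂ] V) (Q x)) ∧
      ‖Q‖ ≤ 1 ∧
      (∀ x ∈ fixedVectors π,
        Q x ∈ fixedVectors (θ.comp (BohrCompactification.ι Γ)) ∧ ‖Q x‖ = ‖x‖) ∧
      ∀ (x : H) (γ : Γ),
        ((inner ℂ (averageOp θ μ (Q x))
          ((θ (BohrCompactification.ι Γ γ) : V →L[ℂ] V) (Q x))).re : ℂ) =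
        1 / (α : ℂ) * meanIntegral Λ A (reCoeff π x ((π γ : H →L[ℂ] H) x)) := by
  obtain ⟨μ, hprob, hreg, hle, hsupp, hint⟩ :=
    BohrCompactification.exists_conditional_measure hΛ A α hA hα
  have hθ := stronglyContinuous_almostPeriodicRep π
  refine ⟨μ, almostPeriodicVectors π, inferInstance, inferInstance, inferInstance,
    almostPeriodicRep π, (almostPeriodicVectors π).orthogonalProjectionOnto, hprob, hreg,
    Measure.absolutelyContinuous_of_le_smul hle, hsupp, eLpNorm_rnDeriv_le_of_le_smul hle, hθ,
    fun γ x => Subtype.ext ?_, Submodule.orthogonalProjectionOnto_norm_le _, fun x hx => ?_,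
    fun x γ => ?_⟩
  · rw [orthogonalProjectionOnto_map, coe_almostPeriodicRep_ι]
  · have hxV := fixedVectors_le_almostPeriodicVectors π hx
    have hQ : ((almostPeriodicVectors π).orthogonalProjectionOnto x : H) = x :=
      Submodule.starProjection_eq_self_iff.mpr hxV
    refine ⟨fun γ => Subtype.ext ?_, ?_⟩
    · change ((almostPeriodicRep π (BohrCompactification.ι Γ γ) :
        almostPeriodicVectors π →L[ℂ] almostPeriodicVectors π) _ : H) = _
      rw [coe_almostPeriodicRep_ι, hQ, hx γ]
    · exact congrArg norm hQ
  · rw [re_inner_averageOp hθ, meanIntegral_reCoeff_eq π hΛ]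
    -- Strong continuity makes the correlation continuous on `bΓ`; its pullback to `Γ` is
    -- definitionally the coefficient under the mean.
    exact hint ⟨fun k => (inner ℂ ((almostPeriodicRep π k :
      almostPeriodicVectors π →L[ℂ] almostPeriodicVectors π) _) _ : ℂ).re,
      Complex.continuous_re.comp ((hθ _).inner continuous_const)⟩
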